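/- **Setting.** Let $T\ge 0$, $\tilde q,k,v_\infty,\delta_\infty>0$, $\tilde\epsilon\in(0,\tilde q)$, and $\mathcal Q=[-\tilde q,\tilde q]$. Let $\Lambda^b,\Lambda^a:\mathbb R\to\mathbb R$ be $C^2$ with negative derivative, limit $0$ at $+\infty$ and $\sup_{\delta}\Lambda\Lambda''/(\Lambda')^2<2$ (for $\Lambda=\Lambda^b,\Lambda^a$). Let $\mu^b,\mu^a$ be probability measures on $(0,\infty)$, absolutely continuous with respect to the Lebesgue measure, with finite means $\Delta^b,\Delta^a$. Let $L:\mathbb R\to\mathbb R_+$ be strictly convex with $L(0)=0$, increasing on $\mathbb R_+$, decreasing on $\mathbb R_-$, with $L(w)/|w|\to+\infty$ as $|w|\to\infty$; let $\psi,\ell:\mathbb R\to\mathbb R_+$ be continuous, and let $\zeta:\mathbb R\to[0,1]$ be Lipschitz with $\zeta=1$ on $[\tilde\epsilon,\infty)$ and $\zeta=0$ on $(-\infty,0]$. With $v_-=\max(-v,0)$, $v_+=\max(v,0)$, put $$w(v,q)=-v_-\zeta(\tilde q+q)+v_+\zeta(\tilde q-q),\qquad \tilde{\mathcal L}(v,q)=L(-v_-)\zeta(\tilde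 q+q)+L(v_+)\zeta(\tilde q-q),$$ $$H^{b}(p)=\sup_{\delta\ge-\delta_\infty}\Lambda^{b}(\delta)(\delta-p),\qquad H^{a}(p)=\sup_{\delta\ge-\delta_\infty}\Lambda^{a}(\delta)(\delta-p).$$ Let $(\Omega,\mathcal F,\mathbb P;(\mathcal F_t)_{t\ge0})$ be a filtered probability space satisfying the usual conditions, with predictable $\sigma$-algebra $\mathcal P$. An admissible control is a pair $(\delta,v)$, where $\delta=(\delta^b,\delta^a):\Omega\times[0,T]\times(0,\infty)\to\mathbb R^2$ is $\mathcal P\otimes\mathcal B((0,\infty))$-measurable with $\delta^b\wedge\delta^a\ge-\delta_\infty$ $\mathbb P\otimes dt\otimes dz$-a.e., and $v:\Omega\times[0,T]\to\mathbb R$ is $\mathcal P$-measurable with $|v|\le v_\infty$ $\mathbb P\otimes dt$-a.e. Let $\mathcal A$ be the set of admissible controls. The probability space is assumed to be large enough to support, for every $(t,q)\in[0,T]\times\mathcal Q$ and $(\delta,v)\in\mathcal A$, a controlled inventory process $(q_s)_{s\ge t}=(q^{t,q,\delta,v}_s)_{s\ge t}$, i.e. an adapted càdlàg process with $q_t=q$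 (and $q_{t-}=q$) and $$dq_s=\int_{(0,\infty)} z\,J^b(ds,dz)-\int_{(0,\infty)} z\,J^a(ds,dz)+w(v_s,q_{s-})\,ds\quad\text{on }(t,T],$$ where $J^b,J^a$ are adapted nonexplosive marked point processes with marks in $(0,\infty)$, almost surely without simultaneous jumps, whose intensity kernels on $(t,T]$ are $\mathbf 1_{\{q_{s-}+z\in\mathcal Q\}}\Lambda^b(\delta^b(s,z))\mu^b(dz)$ and $\mathbf 1_{\{q_{s-}-z\in\mathcal Q\}}\Lambda^a(\delta^a(s,z))\mu^a(dz)$. One such process is fixed for every $(t,q,\delta,v)$. Define $$\mathcal J(t,q,\delta,v)=\mathbb E\Big[\int_t^T\Big\{\int z\delta^b(s,z)\mathbf 1_{\{q_{s-}+z\in\mathcal Q\}}\Lambda^b(\delta^b(s,z))\mu^b(dz)+\int z\delta^a(s,z)\mathbf 1_{\{q_{s-}-z\in\mathcal Q\}}\Lambda^a(\delta^a(s,z))\mu^a(dz)$$ $$\qquad+k\,q_{s-}\,w(v_s,q_{s-})-\tilde{\mathcal L}(v_s,q_{s-})-\psi(q_{s-})\Big\}ds-\ell(q_{T-})\Big]$$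 and the value function $\theta(t,q)=\sup_{(\delta,v)\in\mathcal A}\mathcal J(t,q,\delta,v)$. **Proposition.** All the integrals in the definition of $\mathcal J$ converge, the supremum defining $\theta$ is finite, and for all $(t,q)\in[0,T]\times\mathcal Q$ $$-T\psi(q)-\ell(q)\;\le\;\theta(t,q)\;\le\;T\big(\Delta^bH^b(0)+\Delta^aH^a(0)+k\,v_\infty\,\tilde q\big).$$ In particular $\theta$ is bounded on $[0,T]\times\mathcal Q$. -/

import Mathlib

open MeasureTheory Filter Topology
open scoped NNReal ENNReal

noncomputable section

namespace MarketMaking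

/-! ### Parameters of the model -/

/-- The assumptions on an intensity function `Λ` (of a quote `δ`). The last field says that the
supremum of `Λ Λ'' / (Λ')²` over `ℝ` is less than `2`. -/
structure IntensityFunction (Λ : ℝ → ℝ) : Prop where
  contDiff : ContDiff ℝ 2 Λ
  deriv_neg : ∀ δ, deriv Λ δ < 0
  tendsto_zero : Tendsto Λ atTop (𝓝 0)
  sup_lt_two : ∃ c < (2 : ℝ), ∀ δ, Λ δ * iteratedDeriv 2 Λ δ / (deriv Λ δ) ^ 2 ≤ c

/-- A distribution of trade sizes: a probability measure carried by `(0, ∞)`, absolutely continuous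
with respect to the Lebesgue measure, with a finite first moment. -/
structure SizeDistribution (μ : Measure ℝ) : Prop where
  prob : IsProbabilityMeasure μ
  carried : μ (Set.Iic 0) = 0
  absCont : μ ≪ volume
  finite_mean : Integrable (fun z : ℝ => z) μ

/-- The assumptions on the execution cost function `L`. -/
structure CostFunction (L : ℝ → ℝ) : Prop where
  nonneg : ∀ w, 0 ≤ L w
  zero : L 0 = 0
  strictConvex : StrictConvexOn ℝ Set.univ L
  increasing : StrictMonoOn L (Set.Ici 0)
  decreasing : StrictAntiOn L (Set.Iic 0)
  superlinear : Tendsto (fun w => L w / |w|) (cocompact ℝ) atTop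

/-- The parameters of the market making problem with relaxed inventory constraint, with their
standing assumptions. The superscripts `b` and `a` stand for bid and ask. -/
structure Model where
  /-- time horizon -/
  T : ℝ≥0
  /-- risk limit: the inventory is to remain in `[-qmax, qmax]` -/
  qmax : ℝ
  /-- permanent market impact coefficient -/
  k : ℝ
  /-- bound on the control of the execution rate -/
  vmax : ℝ
  /-- the quotes are bounded from below by `-δmin` -/
  δmin : ℝ
  /-- width of the relaxation -/
  ε : ℝ
  Λb : ℝ → ℝ
  Λa : ℝ → ℝ
  μb : Measure ℝ
  μa : Measure ℝ
  L : ℝ → ℝ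
  ψ : ℝ → ℝ
  ℓ : ℝ → ℝ
  ζ : ℝ → ℝ
  qmax_pos : 0 < qmax
  k_pos : 0 < k
  vmax_pos : 0 < vmax
  δmin_pos : 0 < δmin
  ε_mem : ε ∈ Set.Ioo 0 qmax
  hΛb : IntensityFunction Λb
  hΛa : IntensityFunction Λa
  hμb : SizeDistribution μb
  hμa : SizeDistribution μa
  hL : CostFunction L
  ψ_cont : Continuous ψ
  ψ_nonneg : ∀ q, 0 ≤ ψ q
  ℓ_cont : Continuous ℓ
  ℓ_nonneg : ∀ q, 0 ≤ ℓ q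
  ζ_mem : ∀ q, ζ q ∈ Set.Icc (0 : ℝ) 1
  ζ_lipschitz : ∃ K : ℝ≥0, LipschitzWith K ζ
  ζ_one : ∀ q, ε ≤ q → ζ q = 1
  ζ_zero : ∀ q, q ≤ 0 → ζ q = 0

namespace Model

variable (M : Model)

/-- The set of allowed inventories. -/
def Q : Set ℝ := Set.Icc (-M.qmax) M.qmax

/-- The mean trade size at the bid. -/
def Δb : ℝ := ∫ z, z ∂M.μb

/-- The mean trade size at the ask. -/
def Δa : ℝ := ∫ z, z ∂M.μa

/-- `H^b(p) = sup_{δ ≥ -δmin} Λ^b(δ) (δ - p)`. -/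
def Hb (p : ℝ) : ℝ := ⨆ δ : Set.Ici (-M.δmin), M.Λb δ * ((δ : ℝ) - p)

/-- `H^a(p) = sup_{δ ≥ -δmin} Λ^a(δ) (δ - p)`. -/
def Ha (p : ℝ) : ℝ := ⨆ δ : Set.Ici (-M.δmin), M.Λa δ * ((δ : ℝ) - p)

/-- The execution rate `-v₋ ζ(qmax + q) + v₊ ζ(qmax - q)` induced by the control value `v` when the
inventory is `q`. -/
def rate (v q : ℝ) : ℝ :=
  -(max (-v) 0) * M.ζ (M.qmax + q) + max v 0 * M.ζ (M.qmax - q)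

/-- The relaxed execution cost `L(-v₋) ζ(qmax + q) + L(v₊) ζ(qmax - q)`. -/
def cost (v q : ℝ) : ℝ :=
  M.L (-(max (-v) 0)) * M.ζ (M.qmax + q) + M.L (max v 0) * M.ζ (M.qmax - q)

end Model

/-! ### Time, filtrations, marked point processes -/

/-- The Lebesgue measure `dt` on the time axis `[0, ∞)`. -/
def dt : Measure ℝ≥0 := Measure.comap (fun t : ℝ≥0 => (t : ℝ)) volume

theorem dt_Ioc (s t : ℝ≥0) : dt (Set.Ioc s t) = ENNReal.ofReal ((t : ℝ) - s) := by
  have he : MeasurableEmbedding (fun t : ℝ≥0 => (t : ℝ)) :=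
    MeasurableEmbedding.subtype_coe measurableSet_Ici
  have himg : (fun t : ℝ≥0 => (t : ℝ)) '' Set.Ioc s t = Set.Ioc (s : ℝ) t := by
    ext x
    constructor
    · rintro ⟨y, ⟨h1, h2⟩, rfl⟩
      exact ⟨by exact_mod_cast h1, by exact_mod_cast h2⟩
    · rintro ⟨h1, h2⟩
      exact ⟨⟨x, s.2.trans h1.le⟩, ⟨h1, h2⟩, rfl⟩
  rw [dt, he.comap_apply, himg, Real.volume_Ioc]

variable {Ω : Type*} {mΩ : MeasurableSpace Ω}

/-- The usual conditions: the filtration is right-continuous, and all subsets of `P`-null sets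
belong to the initial `σ`-algebra (`P` is the outer measure here; in particular `P` is complete). -/
structure UsualConditions (P : Measure Ω) (𝔽 : Filtration ℝ≥0 mΩ) : Prop where
  rightCont : ∀ t, (⨅ s > t, 𝔽 s) = 𝔽 t
  null_mem : ∀ A : Set Ω, P A = 0 → MeasurableSet[𝔽 0] A

/-- The `σ`-algebra on `([0, ∞) × Ω) × ℝ` generated by the predictable sets and the Borel sets of
marks. -/
abbrev predictableMarked (𝔽 : Filtration ℝ≥0 mΩ) : MeasurableSpace ((ℝ≥0 × Ω) × ℝ) :=
  @Prod.instMeasurableSpace (ℝ≥0 × Ω) ℝ 𝔽.predictable inferInstance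

/-- A (nonexplosive, adapted, simple) marked point process with marks in `(0, ∞)`, given by its
random set of points `(time, mark)`. -/
structure MarkedPointProcess (𝔽 : Filtration ℝ≥0 mΩ) where
  points : Ω → Set (ℝ≥0 × ℝ)
  pos : ∀ ω, ∀ p ∈ points ω, 0 < p.1 ∧ 0 < p.2
  simple : ∀ ω, ∀ p ∈ points ω, ∀ p' ∈ points ω, p.1 = p'.1 → p = p'
  locallyFinite : ∀ ω (t : ℝ≥0), {p ∈ points ω | p.1 ≤ t}.Finite
  adapted : ∀ (t : ℝ≥0) (B : Set ℝ), MeasurableSet B →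
    Measurable[𝔽 t] fun ω => {p ∈ points ω | p.1 ≤ t ∧ p.2 ∈ B}.encard

/-- The random counting measure `J(dt, dz)` of a marked point process. -/
def MarkedPointProcess.measure {𝔽 : Filtration ℝ≥0 mΩ} (J : MarkedPointProcess 𝔽) (ω : Ω) :
    Measure (ℝ≥0 × ℝ) :=
  Measure.count.restrict (J.points ω)

/-- The marked point process `J` has on the time interval `(t, T]` the `𝔽`-intensity kernel
`ν s ω (dz)`: for every nonnegative predictable `H(s, ω, z)`,
`E[∫_(t,T] ∫ H(s, z) J(ds, dz)] = E[∫_t^T ∫ H(s, z) ν_s(dz) ds]`. -/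
def MarkedPointProcess.HasIntensityKernel {𝔽 : Filtration ℝ≥0 mΩ} (J : MarkedPointProcess 𝔽)
    (P : Measure Ω) (t T : ℝ≥0) (ν : ℝ≥0 → Ω → Measure ℝ) : Prop :=
  ∀ H : (ℝ≥0 × Ω) × ℝ → ℝ≥0∞, Measurable[predictableMarked 𝔽] H →
    ∫⁻ ω, ∫⁻ p in Set.Ioc t T ×ˢ Set.univ, H ((p.1, ω), p.2) ∂(J.measure ω) ∂P =
      ∫⁻ ω, ∫⁻ s in Set.Ioc t T, ∫⁻ z, H ((s, ω), z) ∂(ν s ω) ∂dt ∂P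

/-! ### Controls and controlled inventories -/

/-- An admissible control `((δ^b, δ^a), v)`. Only the values at times in `[0, T]` and sizes in
`(0, ∞)` matter. -/
structure Control (M : Model) (P : Measure Ω) (𝔽 : Filtration ℝ≥0 mΩ) where
  δb : (ℝ≥0 × Ω) × ℝ → ℝ
  δa : (ℝ≥0 × Ω) × ℝ → ℝ
  v : ℝ≥0 × Ω → ℝ
  δb_meas : Measurable[predictableMarked 𝔽] δb
  δa_meas : Measurable[predictableMarked 𝔽] δa
  v_meas : Measurable[𝔽.predictable] v
  δ_bound : ∀ᵐ x ∂(((dt.restrict (Set.Iic M.T)).prod P).prod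
    ((volume : Measure ℝ).restrict (Set.Ioi 0))), -M.δmin ≤ min (δb x) (δa x)
  v_bound : ∀ᵐ x ∂((dt.restrict (Set.Iic M.T)).prod P), |v x| ≤ M.vmax

/-- The kernel `1_{q + z ∈ Q} Λ^b(δ^b(s, z)) μ^b(dz)`. -/
def Model.bidKernel (M : Model) (q : ℝ) (δ : ℝ → ℝ) : Measure ℝ :=
  M.μb.withDensity ({z | q + z ∈ M.Q}.indicator fun z => ENNReal.ofReal (M.Λb (δ z)))

/-- The kernel `1_{q - z ∈ Q} Λ^a(δ^a(s, z)) μ^a(dz)`. -/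
def Model.askKernel (M : Model) (q : ℝ) (δ : ℝ → ℝ) : Measure ℝ :=
  M.μa.withDensity ({z | q - z ∈ M.Q}.indicator fun z => ENNReal.ofReal (M.Λa (δ z)))

/-- A realization of the inventory process started from `q₀` at time `t` and controlled by `c`,
on the stochastic basis `(Ω, P, 𝔽)`: transactions at the bid and at the ask (`Jb`, `Ja`) with
the controlled intensity kernels and without common jump times, and an adapted càdlàg process `X`,
constant equal to `q₀` up to time `t`, with
`dX_s = ∫ z Jb(ds, dz) - ∫ z Ja(ds, dz) + rate(v_s, X_{s-}) ds` on `(t, T]`. -/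
structure ControlledInventory (M : Model) (P : Measure Ω) (𝔽 : Filtration ℝ≥0 mΩ)
    (t : ℝ≥0) (q₀ : ℝ) (c : Control M P 𝔽) where
  Jb : MarkedPointProcess 𝔽
  Ja : MarkedPointProcess 𝔽
  X : ℝ≥0 → Ω → ℝ
  X_adapted : ∀ s, Measurable[𝔽 s] (X s)
  X_rightCont : ∀ ω s, ContinuousWithinAt (fun r => X r ω) (Set.Ioi s) s
  X_leftLim : ∀ ω s, ∃ l, Tendsto (fun r => X r ω) (𝓝[<] s) (𝓝 l)
  X_init : ∀ ω, ∀ s ≤ t, X s ω = q₀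
  no_common_jump : ∀ᵐ ω ∂P, ∀ p ∈ Jb.points ω, ∀ p' ∈ Ja.points ω, p.1 ≠ p'.1
  dynamics : ∀ᵐ ω ∂P, ∀ s ∈ Set.Icc t M.T,
    X s ω = q₀ + ∫ p in Set.Ioc t s ×ˢ Set.univ, p.2 ∂(Jb.measure ω)
      - ∫ p in Set.Ioc t s ×ˢ Set.univ, p.2 ∂(Ja.measure ω)
      + ∫ r in Set.Ioc t s, M.rate (c.v (r, ω)) (Function.leftLim (fun r => X r ω) r) ∂dt
  bid_intensity : Jb.HasIntensityKernel P t M.T fun s ω =>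
    M.bidKernel (Function.leftLim (fun r => X r ω) s) fun z => c.δb ((s, ω), z)
  ask_intensity : Ja.HasIntensityKernel P t M.T fun s ω =>
    M.askKernel (Function.leftLim (fun r => X r ω) s) fun z => c.δa ((s, ω), z)

/-- The inventory processes `q^{t,q,δ,v}`, one for each starting time `t ∈ [0, T]`, each starting
state `q ∈ Q` and each admissible control. That such processes are given is the assumption
that the stochastic basis is large enough to support all the processes of the model. -/
abbrev InventoryFamily (M : Model) (P : Measure Ω) (𝔽 : Filtration ℝ≥0 mΩ) :=
  ∀ (t : Set.Iic M.T) (q : M.Q) (c : Control M P 𝔽), ControlledInventory M P 𝔽 t q c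

/-! ### Criterion and value function -/

section Criterion

variable {M : Model} {P : Measure Ω} {𝔽 : Filtration ℝ≥0 mΩ} {t : ℝ≥0} {q₀ : ℝ}
  {c : Control M P 𝔽}

/-- The left limit `X_{s-}` of the inventory. -/
def ControlledInventory.left (I : ControlledInventory M P 𝔽 t q₀ c) (s : ℝ≥0) (ω : Ω) : ℝ :=
  Function.leftLim (fun r => I.X r ω) s

/-- `z δ^b(s,z) 1_{X_{s-} + z ∈ Q} Λ^b(δ^b(s,z))`. -/
def ControlledInventory.bidGain (I : ControlledInventory M P 𝔽 t q₀ c) (s : ℝ≥0) (ω : Ω)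
    (z : ℝ) : ℝ :=
  {z | I.left s ω + z ∈ M.Q}.indicator
    (fun z => z * c.δb ((s, ω), z) * M.Λb (c.δb ((s, ω), z))) z

/-- `z δ^a(s,z) 1_{X_{s-} - z ∈ Q} Λ^a(δ^a(s,z))`. -/
def ControlledInventory.askGain (I : ControlledInventory M P 𝔽 t q₀ c) (s : ℝ≥0) (ω : Ω)
    (z : ℝ) : ℝ :=
  {z | I.left s ω - z ∈ M.Q}.indicator
    (fun z => z * c.δa ((s, ω), z) * M.Λa (c.δa ((s, ω), z))) z

/-- The running reward at time `s`. -/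
def ControlledInventory.running (I : ControlledInventory M P 𝔽 t q₀ c) (s : ℝ≥0) (ω : Ω) : ℝ :=
  (∫ z, I.bidGain s ω z ∂M.μb) + (∫ z, I.askGain s ω z ∂M.μa)
    + M.k * I.left s ω * M.rate (c.v (s, ω)) (I.left s ω)
    - M.cost (c.v (s, ω)) (I.left s ω) - M.ψ (I.left s ω)

/-- The total reward over `[t, T]`. -/
def ControlledInventory.total (I : ControlledInventory M P 𝔽 t q₀ c) (ω : Ω) : ℝ :=
  (∫ s in Set.Ioc t M.T, I.running s ω ∂dt) - M.ℓ (I.left M.T ω)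

/-- All the integrals that enter the expected total reward converge. -/
def ControlledInventory.WellDefined (I : ControlledInventory M P 𝔽 t q₀ c) : Prop :=
  (∀ᵐ ω ∂P, ∀ᵐ s ∂(dt.restrict (Set.Ioc t M.T)),
    Integrable (I.bidGain s ω) M.μb ∧ Integrable (I.askGain s ω) M.μa) ∧
  (∀ᵐ ω ∂P, IntegrableOn (fun s => I.running s ω) (Set.Ioc t M.T) dt) ∧
  Integrable I.total P

end Criterion

/-- The criterion `𝒥(t, q, δ, v)`. -/
def criterion {M : Model} {P : Measure Ω} {𝔽 : Filtration ℝ≥0 mΩ} (F : InventoryFamily M P 𝔽)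
    (t : Set.Iic M.T) (q : M.Q) (c : Control M P 𝔽) : ℝ :=
  ∫ ω, (F t q c).total ω ∂P

/-- The value function `θ(t, q)`. -/
def valueFunction {M : Model} {P : Measure Ω} {𝔽 : Filtration ℝ≥0 mΩ} (F : InventoryFamily M P 𝔽)
    (t : Set.Iic M.T) (q : M.Q) : ℝ :=
  ⨆ c : Control M P 𝔽, criterion F t q c

end MarketMaking

end

/-! Everything rests on the invariance of `Q`: almost surely the inventory stays in `[-qmax, qmax]`
up to `T`. A jump out of `Q` is not charged by the intensity kernels
(`HasIntensityKernel.ae_notMem`), so almost surely none occurs. Between jumps the path moves only by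
the drift, and at or beyond a limit `ζ` vanishes on the side that would push further out. The
deterministic lemma `le_of_barrier` combines the two facts into `RegularPath.X_mem`.

Upper bound. The condition `Λ Λ'' / (Λ')² < 2` forces `δ Λ(δ)` to be bounded above
(`exists_mul_le`), so `Hb 0` and `Ha 0` are genuine suprema. On `Q` a trade of size `z` then
contributes at most `z H(0)`, the drift term at most `k vmax qmax`, and the costs and penalties only
subtract. Integrating over `μ`, time and `Ω` gives the bound. The same estimates in absolute value,
with deterministic constants, give convergence of all integrals.

Lower bound. The natural strategy is never to trade, but it is not available: `Λ` is positive at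
every finite quote. It is approximated by `v = 0` and constant quotes `n` on both sides. By Markov's
inequality a transaction occurs with probability at most `(Λb n + Λa n) (T - t)`. Without
transactions the inventory remains at `q` and the reward is at least `-T ψ(q) - ℓ(q)`, since gains
at quotes `n ≥ 0` are nonnegative. On the exceptional event, invariance of `Q` bounds the loss
uniformly in `n` (`le_integral_total_const`). Letting `n → ∞` removes the error, because `Λ → 0`. -/

namespace MarketMaking

/-! ### Intensity functions -/

namespace IntensityFunction

variable {Λ : ℝ → ℝ}

theorem strictAnti (h : IntensityFunction Λ) : StrictAnti Λ :=
  strictAnti_of_deriv_neg h.deriv_neg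

theorem pos (h : IntensityFunction Λ) (δ : ℝ) : 0 < Λ δ :=
  lt_of_le_of_lt (h.strictAnti.antitone.le_of_tendsto h.tendsto_zero (δ + 1))
    (h.strictAnti (lt_add_one δ))

theorem hasDerivAt (h : IntensityFunction Λ) (δ : ℝ) : HasDerivAt Λ (deriv Λ δ) δ :=
  (h.contDiff.differentiable (by norm_num) δ).hasDerivAt

theorem hasDerivAt_deriv (h : IntensityFunction Λ) (δ : ℝ) :
    HasDerivAt (deriv Λ) (iteratedDeriv 2 Λ δ) δ := by
  have h1 : ContDiff ℝ 1 (deriv Λ) := by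
    have := h.contDiff
    rw [show (2 : WithTop ℕ∞) = 1 + 1 by norm_num, contDiff_succ_iff_deriv] at this
    exact this.2.2
  have := (h1.differentiable (by norm_num) δ).hasDerivAt
  rwa [iteratedDeriv_succ, iteratedDeriv_one]

/-- The condition `Λ Λ'' / (Λ')² ≤ 2` makes `δ ↦ Λ δ / Λ' δ + δ` nondecreasing. -/
theorem monotone_div_deriv_add (h : IntensityFunction Λ) :
    Monotone fun δ => Λ δ / deriv Λ δ + δ := by
  obtain ⟨c, hc, hs⟩ := h.sup_lt_two
  have hd : ∀ δ, HasDerivAt (fun δ => Λ δ / deriv Λ δ + δ)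
      ((deriv Λ δ * deriv Λ δ - Λ δ * iteratedDeriv 2 Λ δ) / (deriv Λ δ) ^ 2 + 1) δ := fun δ =>
    ((h.hasDerivAt δ).div (h.hasDerivAt_deriv δ) (h.deriv_neg δ).ne).add (hasDerivAt_id δ)
  refine monotone_of_deriv_nonneg (fun δ => (hd δ).differentiableAt) fun δ => ?_
  rw [(hd δ).deriv, sub_div, ← sq, div_self (pow_ne_zero 2 (h.deriv_neg δ).ne)]
  linarith [hs δ]

/-- With `A = -Λ 0 / Λ' 0`, monotonicity of `Λ / Λ' + δ` on `[0, ∞)` reads `Λ + (A + δ) Λ' ≤ 0`,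
because `Λ' < 0`. This says that `(A + δ) Λ(δ)` decreases from its value `A Λ 0`: the intensity
decays at least like `1 / (A + δ)`. -/
theorem exists_mul_le (h : IntensityFunction Λ) : ∃ C, 0 ≤ C ∧ ∀ δ, Λ δ * δ ≤ C := by
  set A := -(Λ 0 / deriv Λ 0) with hA
  have hA0 : 0 ≤ A := by
    rw [hA, neg_nonneg]
    exact div_nonpos_of_nonneg_of_nonpos (h.pos 0).le (h.deriv_neg 0).le
  have hd : ∀ δ, HasDerivAt (fun δ => (A + δ) * Λ δ) (1 * Λ δ + (A + δ) * deriv Λ δ) δ := fun δ =>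
    ((hasDerivAt_id δ).const_add A).mul (h.hasDerivAt δ)
  have hanti : AntitoneOn (fun δ => (A + δ) * Λ δ) (Set.Ici 0) := by
    refine antitoneOn_of_deriv_nonpos (convex_Ici 0)
      (fun δ _ => (hd δ).continuousAt.continuousWithinAt)
      (fun δ _ => (hd δ).differentiableAt.differentiableWithinAt) fun δ hδ => ?_
    rw [interior_Ici] at hδ
    rw [(hd δ).deriv]
    have hm := h.monotone_div_deriv_add hδ.le
    have h2 : -(A + δ) ≤ Λ δ / deriv Λ δ := by
      simp only [add_zero] at hm
      linarith
    rw [le_div_iff_of_neg (h.deriv_neg δ)] at h2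
    linarith
  refine ⟨A * Λ 0, mul_nonneg hA0 (h.pos 0).le, fun δ => ?_⟩
  rcases le_total δ 0 with hδ | hδ
  · exact (mul_nonpos_of_nonneg_of_nonpos (h.pos δ).le hδ).trans (mul_nonneg hA0 (h.pos 0).le)
  · have := hanti (Set.mem_Ici.2 le_rfl) (Set.mem_Ici.2 hδ) hδ
    simp only [add_zero] at this
    nlinarith [mul_nonneg hA0 (h.pos δ).le]

/-- The floor `-m` on the quotes is essential for the lower bound: `δ Λ(δ)` may tend to `-∞` as `δ →
-∞`. -/
theorem exists_abs_mul_le (h : IntensityFunction Λ) (m : ℝ) :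
    ∃ C, 0 ≤ C ∧ ∀ δ, -m ≤ δ → |δ * Λ δ| ≤ C := by
  obtain ⟨C, hC, hb⟩ := h.exists_mul_le
  refine ⟨max C (|m| * Λ (-m)), le_max_of_le_left hC, fun δ hδ => ?_⟩
  rw [abs_le]
  constructor
  · rw [neg_le]
    refine le_max_of_le_right ?_
    have h1 : Λ δ ≤ Λ (-m) := h.strictAnti.antitone hδ
    have h2 : -δ ≤ |m| := by linarith [le_abs_self m]
    calc -(δ * Λ δ) = (-δ) * Λ δ := by ring
      _ ≤ |m| * Λ δ := mul_le_mul_of_nonneg_right h2 (h.pos δ).le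
      _ ≤ |m| * Λ (-m) := mul_le_mul_of_nonneg_left h1 (abs_nonneg m)
  · rw [mul_comm]
    exact le_max_of_le_left (hb δ)

theorem continuous (h : IntensityFunction Λ) : Continuous Λ := h.contDiff.continuous

end IntensityFunction

theorem SizeDistribution.ae_pos {μ : Measure ℝ} (h : SizeDistribution μ) : ∀ᵐ z ∂μ, 0 < z := by
  rw [ae_iff]
  simp only [not_lt]
  exact h.carried

/-! ### Bounds on the Hamiltonians, the execution rate and the cost -/

namespace Model

variable (M : Model)

theorem mul_le_Hb {δ : ℝ} (hδ : -M.δmin ≤ δ) : δ * M.Λb δ ≤ M.Hb 0 := by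
  obtain ⟨C, -, hC⟩ := M.hΛb.exists_mul_le
  -- A real `⨆` over an unbounded family is `0` by default, so boundedness must be proved before `Hb
  -- 0` dominates anything.
  have hb : BddAbove (Set.range fun δ : Set.Ici (-M.δmin) => M.Λb δ * ((δ : ℝ) - 0)) := by
    refine ⟨C, ?_⟩
    rintro _ ⟨x, rfl⟩
    simpa using hC x
  simpa [Hb, mul_comm] using le_ciSup hb (⟨δ, hδ⟩ : Set.Ici (-M.δmin))

theorem mul_le_Ha {δ : ℝ} (hδ : -M.δmin ≤ δ) : δ * M.Λa δ ≤ M.Ha 0 := by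
  obtain ⟨C, -, hC⟩ := M.hΛa.exists_mul_le
  have hb : BddAbove (Set.range fun δ : Set.Ici (-M.δmin) => M.Λa δ * ((δ : ℝ) - 0)) := by
    refine ⟨C, ?_⟩
    rintro _ ⟨x, rfl⟩
    simpa using hC x
  simpa [Ha, mul_comm] using le_ciSup hb (⟨δ, hδ⟩ : Set.Ici (-M.δmin))

theorem Hb_nonneg : 0 ≤ M.Hb 0 := by
  simpa using M.mul_le_Hb (neg_nonpos.2 M.δmin_pos.le)

theorem Ha_nonneg : 0 ≤ M.Ha 0 := by
  simpa using M.mul_le_Ha (neg_nonpos.2 M.δmin_pos.le)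

/-- At most one of `v₋`, `v₊` is nonzero, and it is multiplied by a factor in `[0, 1]`. -/
theorem abs_rate_le (v q : ℝ) : |M.rate v q| ≤ |v| := by
  have h1 := M.ζ_mem (M.qmax + q)
  have h2 := M.ζ_mem (M.qmax - q)
  unfold rate
  rcases le_total v 0 with hv | hv
  · rw [max_eq_left (by linarith : (0 : ℝ) ≤ -v), max_eq_right hv, zero_mul, add_zero, neg_neg,
      abs_mul, abs_of_nonneg h1.1]
    exact mul_le_of_le_one_right (abs_nonneg v) h1.2
  · rw [max_eq_right (by linarith : -v ≤ 0), max_eq_left hv, neg_zero, zero_mul, zero_add,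
      abs_mul, abs_of_nonneg h2.1]
    exact mul_le_of_le_one_right (abs_nonneg v) h2.2

/-- Beyond the upper limit `ζ` switches buying off. With `rate_nonneg`, this is the inward drift
needed for the invariance of `Q`. -/
theorem rate_nonpos (v : ℝ) {q : ℝ} (hq : M.qmax ≤ q) : M.rate v q ≤ 0 := by
  unfold rate
  rw [M.ζ_zero (M.qmax - q) (by linarith), mul_zero, add_zero]
  exact mul_nonpos_of_nonpos_of_nonneg (neg_nonpos.2 (le_max_right _ _)) (M.ζ_mem _).1

theorem rate_nonneg (v : ℝ) {q : ℝ} (hq : q ≤ -M.qmax) : 0 ≤ M.rate v q := by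
  unfold rate
  rw [M.ζ_zero (M.qmax + q) (by linarith), mul_zero, zero_add]
  exact mul_nonneg (le_max_right _ _) (M.ζ_mem _).1

theorem rate_zero_left (q : ℝ) : M.rate 0 q = 0 := by simp [rate]

theorem cost_zero_left (q : ℝ) : M.cost 0 q = 0 := by simp [cost, M.hL.zero]

theorem cost_nonneg (v q : ℝ) : 0 ≤ M.cost v q :=
  add_nonneg (mul_nonneg (M.hL.nonneg _) (M.ζ_mem _).1) (mul_nonneg (M.hL.nonneg _) (M.ζ_mem _).1)

theorem cost_le {v : ℝ} (hv : |v| ≤ M.vmax) (q : ℝ) :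
    M.cost v q ≤ M.L (-M.vmax) + M.L M.vmax := by
  obtain ⟨hv1, hv2⟩ := abs_le.1 hv
  have h1 : M.L (-(max (-v) 0)) ≤ M.L (-M.vmax) :=
    M.hL.decreasing.antitoneOn (by simp [M.vmax_pos.le]) (by simp)
      (neg_le_neg (max_le (by linarith) M.vmax_pos.le))
  have h2 : M.L (max v 0) ≤ M.L M.vmax :=
    M.hL.increasing.monotoneOn (by simp) (by simp [M.vmax_pos.le]) (max_le hv2 M.vmax_pos.le)
  exact add_le_add
    ((mul_le_of_le_one_right (M.hL.nonneg _) (M.ζ_mem _).2).trans h1)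
    ((mul_le_of_le_one_right (M.hL.nonneg _) (M.ζ_mem _).2).trans h2)

theorem continuous_ζ : Continuous M.ζ := by
  obtain ⟨K, hK⟩ := M.ζ_lipschitz
  exact hK.continuous

theorem continuous_L : Continuous M.L := by
  have := M.hL.strictConvex.convexOn.continuousOn_interior
  rwa [interior_univ, continuousOn_univ] at this

theorem continuous_rate : Continuous fun p : ℝ × ℝ => M.rate p.1 p.2 := by
  have := M.continuous_ζ
  unfold rate
  fun_prop

theorem continuous_cost : Continuous fun p : ℝ × ℝ => M.cost p.1 p.2 := by
  have := M.continuous_ζ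
  have := M.continuous_L
  unfold cost
  fun_prop

theorem Δb_nonneg : 0 ≤ M.Δb :=
  integral_nonneg_of_ae (M.hμb.ae_pos.mono fun _ hz => hz.le)

theorem Δa_nonneg : 0 ≤ M.Δa :=
  integral_nonneg_of_ae (M.hμa.ae_pos.mono fun _ hz => hz.le)

end Model

/-! ### The time axis -/

theorem measurableEmbedding_coe_nnreal : MeasurableEmbedding (fun t : ℝ≥0 => (t : ℝ)) :=
  MeasurableEmbedding.subtype_coe measurableSet_Ici

instance sigmaFinite_dt : SigmaFinite dt :=
  SigmaFinite.of_map _ measurableEmbedding_coe_nnreal.measurable.aemeasurable (by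
    rw [dt, measurableEmbedding_coe_nnreal.map_comap]
    infer_instance)

instance isFiniteMeasure_dt_Ioc (s t : ℝ≥0) : IsFiniteMeasure (dt.restrict (Set.Ioc s t)) :=
  ⟨by rw [Measure.restrict_apply_univ, dt_Ioc]; exact ENNReal.ofReal_lt_top⟩

theorem dt_real_Ioc {s t : ℝ≥0} (h : s ≤ t) : dt.real (Set.Ioc s t) = t - s := by
  rw [measureReal_def, dt_Ioc, ENNReal.toReal_ofReal (sub_nonneg.2 (by exact_mod_cast h))]

/-! ### Barriers for paths with finitely many jumps -/

/-- A path that moves continuously between finitely many jump times, that does not lie above `c`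
right after a jump, and that does not increase while it is above `c`, does not cross `c`. -/
theorem le_of_barrier {x : ℝ≥0 → ℝ} {c K : ℝ} {t T : ℝ≥0} {S : Set ℝ≥0}
    (hfin : (S ∩ Set.Ioc t T).Finite) (h0 : x t ≤ c)
    (hS : ∀ u ∈ S, t < u → u ≤ T → x u ≤ c)
    (hcont : ∀ r s, t ≤ r → r < s → s ≤ T → (∀ u ∈ Set.Ioc r s, u ∉ S) →
      x s ≤ x r + K * (s - r))
    (hdrift : ∀ r s, t ≤ r → r < s → s ≤ T → (∀ u ∈ Set.Ioc r s, u ∉ S) →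
      (∀ u ∈ Set.Ioc r s, c < x u) → x s ≤ x r)
    {s : ℝ≥0} (hts : t ≤ s) (hsT : s ≤ T) : x s ≤ c := by
  by_contra! hs
  -- If `x s > c`, consider the last time `r` before `s` at which the path is not above `c`.
  set A : Set ℝ≥0 := {u | t ≤ u ∧ u ≤ s ∧ x u ≤ c} with hA
  have hne : A.Nonempty := ⟨t, le_rfl, hts, h0⟩
  have hbdd : BddAbove A := ⟨s, fun u hu => hu.2.1⟩
  set r := sSup A with hr
  have hrs : r ≤ s := csSup_le hne fun u hu => hu.2.1
  have htr : t ≤ r := le_csSup hbdd ⟨le_rfl, hts, h0⟩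
  -- The supremum is attained: otherwise `r` is not a jump time, so by finiteness some left
  -- neighbourhood of `r` has no jumps. There `hcont` limits the rise to `K (r - u)`, too little to
  -- reach `x r` from times `u < r` with `x u ≤ c`.
  have hxr : x r ≤ c := by
    by_contra! hxr
    have htr' : t < r := lt_of_le_of_ne htr (by rintro h; rw [← h] at hxr; linarith)
    have hrS : r ∉ S := fun h => by linarith [hS r h htr' (hrs.trans hsT)]
    have hclosed : IsClosed (S ∩ Set.Ioc t T) := hfin.isClosed
    have hev1 : ∀ᶠ u in 𝓝[≤] r, u ∉ S ∩ Set.Ioc t T :=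
      nhdsWithin_le_nhds (hclosed.isOpen_compl.mem_nhds fun h => hrS h.1)
    have hev2 : ∀ᶠ u : ℝ≥0 in 𝓝[≤] r, K * ((r : ℝ) - u) < x r - c := by
      have : Tendsto (fun u : ℝ≥0 => K * ((r : ℝ) - u)) (𝓝 r) (𝓝 (K * ((r : ℝ) - r))) := by
        have : Continuous fun u : ℝ≥0 => K * ((r : ℝ) - u) := by fun_prop
        exact this.tendsto r
      rw [sub_self, mul_zero] at this
      exact nhdsWithin_le_nhds (this.eventually_lt_const (by linarith))
    obtain ⟨a, har, hIoc⟩ := (mem_nhdsLE_iff_exists_Ioc_subset' htr').1 (hev1.and hev2)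
    obtain ⟨u, hu, hau⟩ := exists_lt_of_lt_csSup hne (max_lt har htr')
    have hur : u ≤ r := le_csSup hbdd hu
    have hur' : u < r := lt_of_le_of_ne hur (by rintro rfl; linarith [hu.2.2])
    have h1 := hcont u r hu.1 hur' (hrs.trans hsT) (fun w hw hwS =>
      (hIoc ⟨(le_max_left _ _).trans_lt (hau.trans hw.1), hw.2⟩).1
        ⟨hwS, hu.1.trans_lt hw.1, hw.2.trans (hrs.trans hsT)⟩)
    have h2 := (hIoc ⟨(le_max_left _ _).trans_lt hau, hur⟩).2
    linarith [hu.2.2]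
  have hrs' : r < s := lt_of_le_of_ne hrs (by rintro h; rw [h] at hxr; linarith)
  have hgt : ∀ u ∈ Set.Ioc r s, c < x u := fun u hu => by
    by_contra! h
    exact absurd (le_csSup hbdd ⟨htr.trans hu.1.le, hu.2, h⟩) (not_le.2 hu.1)
  -- Jumps land at or below `c`, so none occurs on `(r, s]`, where the path is above `c`. Hence
  -- `hdrift` applies and `x s ≤ x r ≤ c`.
  linarith [hdrift r s htr hrs' hsT (fun u hu huS => by
    linarith [hgt u hu, hS u huS (htr.trans_lt hu.1) (hu.2.trans hsT)]) hgt]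

end MarketMaking

namespace MarketMaking

variable {Ω : Type*} {mΩ : MeasurableSpace Ω} {P : Measure Ω} {𝔽 : Filtration ℝ≥0 mΩ}

/-! ### Predictability of left limits -/

theorem predictable_le_prod (𝔽 : Filtration ℝ≥0 mΩ) :
    𝔽.predictable ≤ (Prod.instMeasurableSpace : MeasurableSpace (ℝ≥0 × Ω)) :=
  measurableSpace_le_predictable_of_measurableSet
    (fun A hA => (measurableSet_singleton _).prod (𝔽.le _ A hA))
    fun _ A hA => measurableSet_Ioi.prod (𝔽.le _ A hA)

theorem predictableMarked_le_prod (𝔽 : Filtration ℝ≥0 mΩ) :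
    predictableMarked 𝔽 ≤ (Prod.instMeasurableSpace : MeasurableSpace ((ℝ≥0 × Ω) × ℝ)) :=
  sup_le_sup (MeasurableSpace.comap_mono (predictable_le_prod 𝔽)) le_rfl

theorem _root_.Measurable.of_predictable {β : Type*} [MeasurableSpace β] {f : ℝ≥0 × Ω → β}
    (hf : Measurable[𝔽.predictable] f) : Measurable f :=
  hf.mono (predictable_le_prod 𝔽) le_rfl

theorem _root_.Measurable.of_predictableMarked {β : Type*} [MeasurableSpace β]
    {f : (ℝ≥0 × Ω) × ℝ → β} (hf : Measurable[predictableMarked 𝔽] f) : Measurable f :=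
  hf.mono (predictableMarked_le_prod 𝔽) le_rfl

/-- The largest multiple of `1 / (n + 1)` that is smaller than `s` (and `0` if `s = 0`). -/
noncomputable def gridBefore (n : ℕ) (s : ℝ≥0) : ℝ≥0 := ((⌈s * (n + 1)⌉₊ - 1 : ℕ) : ℝ≥0) / (n + 1)

theorem gridBefore_eq_of_mem_Ioc {n k : ℕ} {s : ℝ≥0}
    (hs : s ∈ Set.Ioc ((k : ℝ≥0) / (n + 1)) (((k + 1 : ℕ) : ℝ≥0) / (n + 1))) :
    gridBefore n s = (k : ℝ≥0) / (n + 1) := by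
  have hn : (0 : ℝ≥0) < n + 1 := by positivity
  have h : ⌈s * (n + 1)⌉₊ = k + 1 := by
    rw [Nat.ceil_eq_iff (by simp)]
    exact ⟨by simpa using (div_lt_iff₀ hn).1 hs.1, (le_div_iff₀ hn).1 hs.2⟩
  rw [gridBefore, h, Nat.add_sub_cancel]

theorem exists_mem_grid (n : ℕ) {s : ℝ≥0} (hs : 0 < s) :
    ∃ k : ℕ, s ∈ Set.Ioc ((k : ℝ≥0) / (n + 1)) (((k + 1 : ℕ) : ℝ≥0) / (n + 1)) := by
  have hn : (0 : ℝ≥0) < n + 1 := by positivity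
  obtain ⟨k, hk⟩ := Nat.exists_eq_succ_of_ne_zero (Nat.ceil_pos.2 (mul_pos hs hn)).ne'
  refine ⟨k, ?_⟩
  rw [Nat.succ_eq_add_one, Nat.ceil_eq_iff (by simp)] at hk
  exact ⟨(div_lt_iff₀ hn).2 (by simpa using hk.1), (le_div_iff₀ hn).2 hk.2⟩

theorem gridBefore_lt (n : ℕ) {s : ℝ≥0} (hs : 0 < s) : gridBefore n s < s := by
  obtain ⟨k, hk⟩ := exists_mem_grid n hs
  rw [gridBefore_eq_of_mem_Ioc hk]
  exact hk.1

theorem tendsto_gridBefore {s : ℝ≥0} (hs : 0 < s) :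
    Tendsto (fun n => gridBefore n s) atTop (𝓝[<] s) := by
  refine tendsto_nhdsWithin_iff.2 ⟨?_, Eventually.of_forall fun n => gridBefore_lt n hs⟩
  have hlim : Tendsto (fun n : ℕ => (s : ℝ) - 1 / ((n : ℝ) + 1)) atTop (𝓝 (s : ℝ)) := by
    simpa using tendsto_const_nhds.sub (tendsto_one_div_add_atTop_nhds_zero_nat (𝕜 := ℝ))
  rw [← NNReal.tendsto_coe]
  refine tendsto_of_tendsto_of_tendsto_of_le_of_le hlim tendsto_const_nhds (fun n => ?_)
    fun n => by exact_mod_cast (gridBefore_lt n hs).le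
  obtain ⟨k, hk⟩ := exists_mem_grid n hs
  have h2 : (s : ℝ) ≤ ((k : ℝ) + 1) / (n + 1) := by exact_mod_cast hk.2
  simp only [gridBefore_eq_of_mem_Ioc hk]
  push_cast
  rw [add_div] at h2
  linarith

/-- The left limits of an adapted process form a predictable process. -/
theorem measurable_leftLim_predictable {X : ℝ≥0 → Ω → ℝ} (hX : ∀ s, Measurable[𝔽 s] (X s))
    (hl : ∀ ω s, ∃ l, Tendsto (fun r => X r ω) (𝓝[<] s) (𝓝 l)) :
    Measurable[𝔽.predictable] fun p : ℝ≥0 × Ω => Function.leftLim (fun r => X r p.2) p.1 := by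
  have happrox : ∀ n, Measurable[𝔽.predictable] fun p : ℝ≥0 × Ω => X (gridBefore n p.1) p.2 := by
    intro n B hB
    -- The sampled process is constant in time on each `(k/(n+1), (k+1)/(n+1)]` and known at its
    -- left endpoint, so preimages are countable unions of predictable rectangles. Time `0` needs
    -- its own.
    have hset : (fun p : ℝ≥0 × Ω => X (gridBefore n p.1) p.2) ⁻¹' B =
        {⊥} ×ˢ (X 0 ⁻¹' B) ∪ ⋃ k : ℕ, Set.Ioc ((k : ℝ≥0) / (n + 1))
          (((k + 1 : ℕ) : ℝ≥0) / (n + 1)) ×ˢ (X ((k : ℝ≥0) / (n + 1)) ⁻¹' B) := by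
      ext ⟨s, ω⟩
      simp only [Set.mem_preimage, Set.mem_union, Set.mem_prod, Set.mem_singleton_iff,
        Set.mem_iUnion]
      constructor
      · intro h
        rcases eq_or_ne s 0 with rfl | hs
        · left
          exact ⟨rfl, by simpa [gridBefore] using h⟩
        · obtain ⟨k, hk⟩ := exists_mem_grid n (pos_iff_ne_zero.2 hs)
          exact Or.inr ⟨k, hk, by rwa [gridBefore_eq_of_mem_Ioc hk] at h⟩
      · rintro (⟨hs, h⟩ | ⟨k, hk, h⟩)
        · rw [bot_eq_zero] at hs
          subst hs
          simpa [gridBefore] using h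
        · rwa [gridBefore_eq_of_mem_Ioc hk]
    rw [hset]
    exact MeasurableSet.union (measurableSet_predictable_singleton_bot_prod (hX 0 hB))
      (MeasurableSet.iUnion fun k => measurableSet_predictable_Ioc_prod _ _ (hX _ hB))
  refine @measurable_of_tendsto_metrizable _ _ 𝔽.predictable _ _ _ _ _ _ happrox ?_
  rw [tendsto_pi_nhds]
  rintro ⟨s, ω⟩
  rcases eq_or_ne s 0 with rfl | hs
  · have : Function.leftLim (fun r => X r ω) 0 = X 0 ω :=
      leftLim_eq_of_isBot (f := fun r => X r ω) isBot_bot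
    simp [gridBefore, this]
  · exact (tendsto_leftLim_of_tendsto (hl ω s)).comp (tendsto_gridBefore (pos_iff_ne_zero.2 hs))

/-! ### Random measures of marked point processes -/

namespace MarkedPointProcess

variable (J : MarkedPointProcess 𝔽)

theorem countable_points (ω : Ω) : (J.points ω).Countable := by
  refine (Set.countable_iUnion fun n : ℕ => (J.locallyFinite ω n).countable).mono fun p hp => ?_
  obtain ⟨n, hn⟩ := exists_nat_ge p.1
  exact Set.mem_iUnion.2 ⟨n, hp, hn⟩

theorem measure_apply (ω : Ω) {A : Set (ℝ≥0 × ℝ)} (hA : MeasurableSet A) :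
    J.measure ω A = ({p ∈ J.points ω | p ∈ A}.encard : ℝ≥0∞) := by
  rw [MarkedPointProcess.measure, Measure.restrict_apply hA, Set.inter_comm,
    Measure.count_apply ((J.countable_points ω).mono Set.inter_subset_left).measurableSet]
  rfl

theorem measure_lt_top (ω : Ω) (T : ℝ≥0) {A : Set (ℝ≥0 × ℝ)} (hA : MeasurableSet A)
    (hT : ∀ p ∈ A, p.1 ≤ T) : J.measure ω A < ∞ := by
  rw [measure_apply J ω hA, ENat.toENNReal_lt_top, Set.encard_lt_top_iff]
  exact (J.locallyFinite ω T).subset fun p hp => ⟨hp.1, hT p hp.2⟩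

/-- Adaptedness controls the counts on `[0, t] × B` only. These rectangles form a generating
π-system, and the restriction to `[0, T]` makes the measures finite, so a π-λ argument applies. -/
theorem measurable_measure_restrict (T : ℝ≥0) :
    Measurable fun ω => (J.measure ω).restrict (Set.Iic T ×ˢ Set.univ) := by
  have hT : MeasurableSet (Set.Iic T ×ˢ (Set.univ : Set ℝ)) :=
    measurableSet_Iic.prod MeasurableSet.univ
  have hfin : ∀ ω, IsFiniteMeasure ((J.measure ω).restrict (Set.Iic T ×ˢ Set.univ)) := fun ω =>
    ⟨by rw [Measure.restrict_apply_univ]; exact J.measure_lt_top ω T hT fun p hp => hp.1⟩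
  have hrect : ∀ (t : ℝ≥0) (B : Set ℝ), MeasurableSet B →
      Measurable fun ω => (J.measure ω).restrict (Set.Iic T ×ˢ Set.univ) (Set.Iic t ×ˢ B) := by
    intro t B hB
    have h1 := (J.adapted (min t T) B hB).mono (𝔽.le _) le_rfl
    have h2 : Measurable fun n : ℕ∞ => (n : ℝ≥0∞) := Measurable.of_discrete
    convert h2.comp h1 using 2 with ω
    rw [Measure.restrict_apply (measurableSet_Iic.prod hB),
      J.measure_apply ω ((measurableSet_Iic.prod hB).inter hT)]
    simp only [Function.comp_apply]
    congr 2
    ext p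
    simp only [Set.mem_ofPred_eq, Set.mem_inter_iff, Set.mem_prod, Set.mem_Iic, Set.mem_univ,
      and_true, le_min_iff]
    tauto
  have hspan : IsCountablySpanning (Set.range (Set.Iic : ℝ≥0 → Set ℝ≥0)) := by
    refine ⟨fun n : ℕ => Set.Iic (n : ℝ≥0), fun n => ⟨n, rfl⟩, ?_⟩
    refine Set.eq_univ_of_forall fun s => ?_
    obtain ⟨n, hn⟩ := exists_nat_ge s
    exact Set.mem_iUnion.2 ⟨n, hn⟩
  have hgen : (Prod.instMeasurableSpace : MeasurableSpace (ℝ≥0 × ℝ)) =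
      MeasurableSpace.generateFrom (Set.image2 (· ×ˢ ·) (Set.range (Set.Iic : ℝ≥0 → Set ℝ≥0))
        {B : Set ℝ | MeasurableSet B}) := by
    rw [← generateFrom_prod_eq hspan isCountablySpanning_measurableSet,
      MeasurableSpace.generateFrom_measurableSet, ← borel_eq_generateFrom_Iic,
      BorelSpace.measurable_eq (α := ℝ≥0)]
  refine Measurable.measure_of_isPiSystem hgen
    (isPiSystem_Iic.prod MeasurableSpace.isPiSystem_measurableSet) ?_ ?_
  · rintro _ ⟨_, ⟨t, rfl⟩, B, hB, rfl⟩
    exact hrect t B hB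
  · convert hrect T Set.univ MeasurableSet.univ using 2 with ω
    simp [Measure.restrict_apply, hT]

theorem measurable_lintegral {H : (ℝ≥0 × Ω) × ℝ → ℝ≥0∞} (hH : Measurable H) (t T : ℝ≥0) :
    Measurable fun ω => ∫⁻ p in Set.Ioc t T ×ˢ Set.univ, H ((p.1, ω), p.2) ∂(J.measure ω) := by
  set μ : Ω → Measure (ℝ≥0 × ℝ) := fun ω => (J.measure ω).restrict (Set.Iic T ×ˢ Set.univ) with hμ
  have hμm : Measurable μ := J.measurable_measure_restrict T
  -- The number of points is finite for each `ω` but not uniformly in `ω`, as a finite kernel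
  -- requires. Dividing by `1 + ` total mass gives mass at most `1`; the factor is restored at the
  -- end.
  set N : Ω → ℝ≥0∞ := fun ω => 1 + μ ω Set.univ with hN
  have hNm : Measurable N := (Measure.measurable_measure.1 hμm _ MeasurableSet.univ).const_add 1
  have hN0 : ∀ ω, N ω ≠ 0 := fun ω => by simp [hN]
  have hNtop : ∀ ω, N ω ≠ ∞ := fun ω => by
    simp only [hN, hμ, Measure.restrict_apply_univ]
    exact ENNReal.add_ne_top.2 ⟨ENNReal.one_ne_top, (J.measure_lt_top ω T
      (measurableSet_Iic.prod MeasurableSet.univ) fun p hp => hp.1).ne⟩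
  let κ : ProbabilityTheory.Kernel Ω (ℝ≥0 × ℝ) :=
    { toFun := fun ω => (N ω)⁻¹ • μ ω
      measurable' := Measure.measurable_of_measurable_coe _ fun s hs => by
        simp only [Measure.smul_apply, smul_eq_mul]
        exact hNm.inv.mul (Measure.measurable_measure.1 hμm s hs) }
  have hκ : ∀ ω, κ ω = (N ω)⁻¹ • μ ω := fun _ => rfl
  have : ProbabilityTheory.IsFiniteKernel κ := ⟨1, ENNReal.one_lt_top, fun ω => by
    rw [hκ, Measure.smul_apply, smul_eq_mul, mul_comm, ← div_eq_mul_inv]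
    exact ENNReal.div_le_of_le_mul (by simp [hN])⟩
  set G : Ω → ℝ≥0 × ℝ → ℝ≥0∞ := fun ω =>
    (Set.Ioc t T ×ˢ Set.univ).indicator fun p => H ((p.1, ω), p.2) with hG
  have hS : MeasurableSet (Set.Ioc t T ×ˢ (Set.univ : Set ℝ)) :=
    measurableSet_Ioc.prod MeasurableSet.univ
  have hGm : Measurable (Function.uncurry G) := by
    have h1 : Measurable fun x : Ω × (ℝ≥0 × ℝ) => H ((x.2.1, x.1), x.2.2) := by fun_prop
    have : Function.uncurry G = (Prod.snd ⁻¹' (Set.Ioc t T ×ˢ (Set.univ : Set ℝ))).indicator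
        fun x : Ω × (ℝ≥0 × ℝ) => H ((x.2.1, x.1), x.2.2) := rfl
    rw [this]
    exact h1.indicator (measurable_snd hS)
  have hmeas := hNm.mul (hGm.lintegral_kernel_prod_right (κ := κ))
  convert hmeas using 2 with ω
  simp only [Pi.mul_apply]
  rw [hκ, lintegral_smul_measure, smul_eq_mul, ← mul_assoc, ENNReal.mul_inv_cancel (hN0 ω) (hNtop ω),
    one_mul, hG, lintegral_indicator hS, hμ, Measure.restrict_restrict hS]
  congr 2
  ext p
  simp only [Set.mem_prod, Set.mem_Ioc, Set.mem_univ, and_true, Set.mem_inter_iff, Set.mem_Iic]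
  tauto

/-- Points that a compensator does not charge do almost surely not occur. -/
theorem HasIntensityKernel.ae_notMem {J : MarkedPointProcess 𝔽} {t T : ℝ≥0}
    {ν : ℝ≥0 → Ω → Measure ℝ} (h : J.HasIntensityKernel P t T ν) {A : Set ((ℝ≥0 × Ω) × ℝ)}
    (hA : MeasurableSet[predictableMarked 𝔽] A) (hν : ∀ s ω, ν s ω {z | ((s, ω), z) ∈ A} = 0) :
    ∀ᵐ ω ∂P, ∀ p ∈ J.points ω, p.1 ∈ Set.Ioc t T → ((p.1, ω), p.2) ∉ A := by
  have hm : Measurable[predictableMarked 𝔽] (A.indicator (1 : (ℝ≥0 × Ω) × ℝ → ℝ≥0∞)) :=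
    Measurable.indicator (@measurable_const _ _ _ (predictableMarked 𝔽) 1) hA
  have hz : ∀ s ω, ∫⁻ z, A.indicator (1 : (ℝ≥0 × Ω) × ℝ → ℝ≥0∞) ((s, ω), z) ∂(ν s ω) = 0 := by
    intro s ω
    have hs : MeasurableSet {z | ((s, ω), z) ∈ A} :=
      measurable_prodMk_left (predictableMarked_le_prod 𝔽 A hA)
    have : (fun z => A.indicator (1 : (ℝ≥0 × Ω) × ℝ → ℝ≥0∞) ((s, ω), z)) =
      {z | ((s, ω), z) ∈ A}.indicator 1 := rfl
    rw [this, lintegral_indicator_one hs, hν]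
  have h0 := h _ hm
  simp only [hz, lintegral_zero] at h0
  rw [lintegral_eq_zero_iff (J.measurable_lintegral hm.of_predictableMarked t T)] at h0
  filter_upwards [h0] with ω hω p hp hpt hpA
  have hsec : MeasurableSet {q : ℝ≥0 × ℝ | ((q.1, ω), q.2) ∈ A} :=
    (by fun_prop : Measurable fun q : ℝ≥0 × ℝ => ((q.1, ω), q.2))
      (predictableMarked_le_prod 𝔽 A hA)
  have : (fun q : ℝ≥0 × ℝ => A.indicator (1 : (ℝ≥0 × Ω) × ℝ → ℝ≥0∞) ((q.1, ω), q.2)) =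
      {q : ℝ≥0 × ℝ | ((q.1, ω), q.2) ∈ A}.indicator 1 := rfl
  rw [this, lintegral_indicator_one hsec, Measure.restrict_apply hsec, J.measure_apply ω
    (hsec.inter (measurableSet_Ioc.prod MeasurableSet.univ))] at hω
  simp only [Pi.zero_apply, ENat.toENNReal_eq_zero, Set.encard_eq_zero] at hω
  exact (Set.eq_empty_iff_forall_notMem.1 hω) p ⟨hp, hpA, hpt, trivial⟩

theorem restrict_Ioc (ω : Ω) (r s : ℝ≥0) : (J.measure ω).restrict (Set.Ioc r s ×ˢ Set.univ) =
    Measure.count.restrict {p ∈ J.points ω | p.1 ∈ Set.Ioc r s} := by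
  rw [MarkedPointProcess.measure, Measure.restrict_restrict
    (measurableSet_Ioc.prod MeasurableSet.univ)]
  congr 1
  ext p
  exact ⟨fun h => ⟨h.2, h.1.1⟩, fun h => ⟨⟨h.2, trivial⟩, h.1⟩⟩

theorem finite_points_Ioc (ω : Ω) (r s : ℝ≥0) : {p ∈ J.points ω | p.1 ∈ Set.Ioc r s}.Finite :=
  Set.Finite.subset (J.locallyFinite ω s) fun _ hp => ⟨hp.1, hp.2.2⟩

theorem integrableOn_Ioc (ω : Ω) (r s : ℝ≥0) (f : ℝ≥0 × ℝ → ℝ) :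
    IntegrableOn f (Set.Ioc r s ×ˢ Set.univ) (J.measure ω) := by
  have hF := J.finite_points_Ioc ω r s
  have : IsFiniteMeasure
      ((Measure.count : Measure (ℝ≥0 × ℝ)).restrict {p ∈ J.points ω | p.1 ∈ Set.Ioc r s}) :=
    ⟨by rw [Measure.restrict_apply_univ]; exact Measure.count_apply_lt_top.2 hF⟩
  have h := IntegrableOn.of_finite (f := f)
    (μ := Measure.count.restrict {p ∈ J.points ω | p.1 ∈ Set.Ioc r s}) hF
  rw [IntegrableOn, Measure.restrict_restrict hF.measurableSet, Set.inter_self] at h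
  rwa [IntegrableOn, restrict_Ioc]

theorem setIntegral_Ioc_add (ω : Ω) {t r s : ℝ≥0} (htr : t ≤ r) (hrs : r ≤ s) (f : ℝ≥0 × ℝ → ℝ) :
    ∫ p in Set.Ioc t s ×ˢ Set.univ, f p ∂(J.measure ω) =
      ∫ p in Set.Ioc t r ×ˢ Set.univ, f p ∂(J.measure ω) +
        ∫ p in Set.Ioc r s ×ˢ Set.univ, f p ∂(J.measure ω) := by
  rw [← Set.Ioc_union_Ioc_eq_Ioc htr hrs, Set.union_prod, setIntegral_union
    (Set.Disjoint.set_prod_left (Set.Ioc_disjoint_Ioc_of_le le_rfl) _ _)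
    (measurableSet_Ioc.prod MeasurableSet.univ) (J.integrableOn_Ioc ω t r f)
    (J.integrableOn_Ioc ω r s f)]

theorem setIntegral_Ioc_eq_zero (ω : Ω) {r s : ℝ≥0} (f : ℝ≥0 × ℝ → ℝ)
    (h : ∀ p ∈ J.points ω, p.1 ∉ Set.Ioc r s) :
    ∫ p in Set.Ioc r s ×ˢ Set.univ, f p ∂(J.measure ω) = 0 := by
  have : {p ∈ J.points ω | p.1 ∈ Set.Ioc r s} = ∅ :=
    Set.eq_empty_of_forall_notMem fun p hp => h p hp.1 hp.2
  rw [restrict_Ioc, this, Measure.restrict_empty, integral_zero_measure]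

theorem setIntegral_Ioc_eq (ω : Ω) {r s : ℝ≥0} (f : ℝ≥0 × ℝ → ℝ) {q : ℝ≥0 × ℝ}
    (hq : q ∈ J.points ω) (hqs : q.1 ∈ Set.Ioc r s)
    (h : ∀ p ∈ J.points ω, p.1 ∈ Set.Ioc r s → p = q) :
    ∫ p in Set.Ioc r s ×ˢ Set.univ, f p ∂(J.measure ω) = f q := by
  have : {p ∈ J.points ω | p.1 ∈ Set.Ioc r s} = {q} :=
    Set.eq_singleton_iff_unique_mem.2 ⟨⟨hq, hqs⟩, fun p hp => h p hp.1 hp.2⟩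
  rw [restrict_Ioc, this, integral_singleton]
  simp [measureReal_def]

end MarkedPointProcess

end MarketMaking

namespace MarketMaking

variable {Ω : Type*} {mΩ : MeasurableSpace Ω} {M : Model} {P : Measure Ω}
  {𝔽 : Filtration ℝ≥0 mΩ} {t : ℝ≥0} {q₀ : ℝ} {c : Control M P 𝔽}

/-! ### Paths of the inventory -/

/-- The exchange of quantifiers turns a bound for almost every `(s, ω)` into a pathwise one. -/
theorem Control.ae_abs_v_le [SFinite P] (c : Control M P 𝔽) :
    ∀ᵐ ω ∂P, ∀ᵐ s ∂(dt.restrict (Set.Iic M.T)), |c.v (s, ω)| ≤ M.vmax := by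
  have hm : MeasurableSet {x : ℝ≥0 × Ω | |c.v x| ≤ M.vmax} :=
    measurableSet_le c.v_meas.of_predictable.abs measurable_const
  exact (Measure.ae_ae_comm hm).1 (Measure.ae_ae_of_ae_prod c.v_bound)

namespace ControlledInventory

variable (I : ControlledInventory M P 𝔽 t q₀ c)

theorem tendsto_left (s : ℝ≥0) (ω : Ω) :
    Tendsto (fun r => I.X r ω) (𝓝[<] s) (𝓝 (I.left s ω)) :=
  tendsto_leftLim_of_tendsto (I.X_leftLim ω s)

theorem measurable_left_predictable :
    Measurable[𝔽.predictable] fun p : ℝ≥0 × Ω => I.left p.1 p.2 :=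
  measurable_leftLim_predictable I.X_adapted I.X_leftLim

theorem measurable_left : Measurable fun p : ℝ≥0 × Ω => I.left p.1 p.2 :=
  I.measurable_left_predictable.of_predictable

theorem left_mem_of_forall_mem {C : Set ℝ} (hC : IsClosed C) {a s : ℝ≥0} {ω : Ω} (has : a < s)
    (h : ∀ r, a < r → r < s → I.X r ω ∈ C) : I.left s ω ∈ C := by
  have : (𝓝[<] s).NeBot := nhdsLT_neBot_of_exists_lt ⟨a, has⟩
  refine hC.mem_of_tendsto (I.tendsto_left s ω) ?_
  filter_upwards [Ioo_mem_nhdsLT has] with r hr using h r hr.1 hr.2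

theorem left_of_le {s : ℝ≥0} (hs : s ≤ t) (ω : Ω) : I.left s ω = q₀ := by
  rcases eq_or_ne s 0 with rfl | h0
  · have : I.left 0 ω = I.X 0 ω := leftLim_eq_of_isBot (f := fun r => I.X r ω) isBot_bot
    rw [this, I.X_init ω 0 hs]
  · exact I.left_mem_of_forall_mem isClosed_singleton (pos_iff_ne_zero.2 h0)
      fun r _ hr => I.X_init ω r (hr.le.trans hs)

/-- The properties of the paths of the inventory process that hold almost surely. -/
structure RegularPath (ω : Ω) : Prop where
  abs_v_le : ∀ᵐ s ∂(dt.restrict (Set.Iic M.T)), |c.v (s, ω)| ≤ M.vmax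
  no_common_jump : ∀ p ∈ I.Jb.points ω, ∀ p' ∈ I.Ja.points ω, p.1 ≠ p'.1
  dynamics : ∀ s ∈ Set.Icc t M.T,
    I.X s ω = q₀ + ∫ p in Set.Ioc t s ×ˢ Set.univ, p.2 ∂(I.Jb.measure ω)
      - ∫ p in Set.Ioc t s ×ˢ Set.univ, p.2 ∂(I.Ja.measure ω)
      + ∫ r in Set.Ioc t s, M.rate (c.v (r, ω)) (I.left r ω) ∂dt
  bid_mem : ∀ p ∈ I.Jb.points ω, p.1 ∈ Set.Ioc t M.T → I.left p.1 ω + p.2 ∈ M.Q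
  ask_mem : ∀ p ∈ I.Ja.points ω, p.1 ∈ Set.Ioc t M.T → I.left p.1 ω - p.2 ∈ M.Q

/-- The last two properties use predictability of left limits: the set of jumps out of `Q` is then
predictable, and the indicator in the kernel gives it zero mass. -/
theorem ae_regularPath [SFinite P] : ∀ᵐ ω ∂P, I.RegularPath ω := by
  have hQ : MeasurableSet M.Qᶜ := (measurableSet_Icc (a := -M.qmax) (b := M.qmax)).compl
  have hfst : Measurable[predictableMarked 𝔽] fun x : (ℝ≥0 × Ω) × ℝ => I.left x.1.1 x.1.2 :=
    I.measurable_left_predictable.comp (@measurable_fst _ _ 𝔽.predictable _)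
  have hsnd : Measurable[predictableMarked 𝔽] fun x : (ℝ≥0 × Ω) × ℝ => x.2 :=
    @measurable_snd _ _ 𝔽.predictable _
  have hbid : ∀ᵐ ω ∂P, ∀ p ∈ I.Jb.points ω, p.1 ∈ Set.Ioc t M.T →
      ((p.1, ω), p.2) ∉ {x : (ℝ≥0 × Ω) × ℝ | I.left x.1.1 x.1.2 + x.2 ∈ M.Qᶜ} := by
    refine I.bid_intensity.ae_notMem ((hfst.add hsnd) hQ) fun s ω => ?_
    have hms : MeasurableSet {z : ℝ | I.left s ω + z ∈ M.Qᶜ} := (measurable_const_add _) hQ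
    refine (withDensity_apply _ hms).trans ?_
    rw [setLIntegral_congr_fun hms (g := fun _ => 0), lintegral_zero]
    exact fun z hz => Set.indicator_of_notMem (s := {z | I.left s ω + z ∈ M.Q}) hz _
  have hask : ∀ᵐ ω ∂P, ∀ p ∈ I.Ja.points ω, p.1 ∈ Set.Ioc t M.T →
      ((p.1, ω), p.2) ∉ {x : (ℝ≥0 × Ω) × ℝ | I.left x.1.1 x.1.2 - x.2 ∈ M.Qᶜ} := by
    refine I.ask_intensity.ae_notMem ((hfst.sub hsnd) hQ) fun s ω => ?_
    have hms : MeasurableSet {z : ℝ | I.left s ω - z ∈ M.Qᶜ} := (measurable_const_sub _) hQ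
    refine (withDensity_apply _ hms).trans ?_
    rw [setLIntegral_congr_fun hms (g := fun _ => 0), lintegral_zero]
    exact fun z hz => Set.indicator_of_notMem (s := {z | I.left s ω - z ∈ M.Q}) hz _
  filter_upwards [c.ae_abs_v_le, I.no_common_jump, I.dynamics, hbid, hask] with ω h1 h2 h3 h4 h5
  exact ⟨h1, h2, h3, fun p hp hpt => not_not.1 (h4 p hp hpt),
    fun p hp hpt => not_not.1 (h5 p hp hpt)⟩

/-- The times of the transactions. -/
def jumpTimes (ω : Ω) : Set ℝ≥0 := Prod.fst '' (I.Jb.points ω ∪ I.Ja.points ω)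

theorem finite_jumpTimes (ω : Ω) (T : ℝ≥0) : (I.jumpTimes ω ∩ Set.Iic T).Finite := by
  refine (((I.Jb.locallyFinite ω T).union (I.Ja.locallyFinite ω T)).image Prod.fst).subset ?_
  rintro _ ⟨⟨p, hp | hp, rfl⟩, hT⟩
  · exact ⟨p, Or.inl ⟨hp, hT⟩, rfl⟩
  · exact ⟨p, Or.inr ⟨hp, hT⟩, rfl⟩

theorem eventually_notMem_jumpTimes (u : ℝ≥0) (ω : Ω) :
    ∀ᶠ r in 𝓝[<] u, ∀ s ∈ Set.Ioo r u, s ∉ I.jumpTimes ω := by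
  -- `u` may itself be a transaction time, so it is removed first.
  have hcl : IsClosed ((I.jumpTimes ω ∩ Set.Iic u) \ {u}) :=
    ((I.finite_jumpTimes ω u).subset Set.sdiff_subset).isClosed
  have hev : ∀ᶠ s in 𝓝[<] u, s ∉ (I.jumpTimes ω ∩ Set.Iic u) \ {u} :=
    nhdsWithin_le_nhds (hcl.isOpen_compl.mem_nhds fun h => h.2 rfl)
  rcases eq_or_ne u 0 with rfl | hu
  · exact Eventually.of_forall fun r s hs => absurd hs.2 (not_lt.2 zero_le)
  · obtain ⟨a, ha, hIoo⟩ := (mem_nhdsLT_iff_exists_Ioo_subset' (pos_iff_ne_zero.2 hu)).1 hev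
    filter_upwards [Ioo_mem_nhdsLT ha] with r hr s hs hsJ
    exact hIoo ⟨hr.1.trans hs.1, hs.2⟩ ⟨⟨hsJ, hs.2.le⟩, hs.2.ne⟩

namespace RegularPath

variable {I} {ω : Ω} (h : I.RegularPath ω)

include h

theorem integrableOn_rate {r s : ℝ≥0} (hs : s ≤ M.T) :
    IntegrableOn (fun u => M.rate (c.v (u, ω)) (I.left u ω)) (Set.Ioc r s) dt := by
  have hm : Measurable fun u => M.rate (c.v (u, ω)) (I.left u ω) :=
    M.continuous_rate.measurable.comp ((c.v_meas.of_predictable.comp measurable_prodMk_right).prodMk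
      (I.measurable_left.comp measurable_prodMk_right))
  refine Integrable.of_bound hm.aestronglyMeasurable M.vmax ?_
  have hle : dt.restrict (Set.Ioc r s) ≤ dt.restrict (Set.Iic M.T) :=
    Measure.restrict_mono (fun u hu => hu.2.trans hs) le_rfl
  filter_upwards [h.abs_v_le.filter_mono (ae_mono hle)] with u hu using (M.abs_rate_le _ _).trans hu

theorem abs_setIntegral_rate_le {r s : ℝ≥0} (hrs : r ≤ s) (hs : s ≤ M.T) :
    |∫ u in Set.Ioc r s, M.rate (c.v (u, ω)) (I.left u ω) ∂dt| ≤ M.vmax * (s - r) := by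
  have hle : dt.restrict (Set.Ioc r s) ≤ dt.restrict (Set.Iic M.T) :=
    Measure.restrict_mono (fun u hu => hu.2.trans hs) le_rfl
  have := norm_integral_le_of_norm_le_const (μ := dt.restrict (Set.Ioc r s)) (C := M.vmax)
    (f := fun u => M.rate (c.v (u, ω)) (I.left u ω))
    ((h.abs_v_le.filter_mono (ae_mono hle)).mono fun u hu => (M.abs_rate_le _ _).trans hu)
  rwa [measureReal_restrict_apply_univ, dt_real_Ioc hrs] at this

theorem increment {r s : ℝ≥0} (htr : t ≤ r) (hrs : r ≤ s) (hs : s ≤ M.T) :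
    I.X s ω = I.X r ω + ∫ p in Set.Ioc r s ×ˢ Set.univ, p.2 ∂(I.Jb.measure ω)
      - ∫ p in Set.Ioc r s ×ˢ Set.univ, p.2 ∂(I.Ja.measure ω)
      + ∫ u in Set.Ioc r s, M.rate (c.v (u, ω)) (I.left u ω) ∂dt := by
  rw [h.dynamics s ⟨htr.trans hrs, hs⟩, h.dynamics r ⟨htr, hrs.trans hs⟩,
    I.Jb.setIntegral_Ioc_add ω htr hrs, I.Ja.setIntegral_Ioc_add ω htr hrs,
    ← Set.Ioc_union_Ioc_eq_Ioc htr hrs, setIntegral_union (Set.Ioc_disjoint_Ioc_of_le le_rfl)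
    measurableSet_Ioc (h.integrableOn_rate (hrs.trans hs)) (h.integrableOn_rate hs)]
  ring

theorem increment_of_notMem {r s : ℝ≥0} (htr : t ≤ r) (hrs : r ≤ s) (hs : s ≤ M.T)
    (hJ : ∀ u ∈ Set.Ioc r s, u ∉ I.jumpTimes ω) :
    I.X s ω = I.X r ω + ∫ u in Set.Ioc r s, M.rate (c.v (u, ω)) (I.left u ω) ∂dt := by
  rw [h.increment htr hrs hs,
    I.Jb.setIntegral_Ioc_eq_zero ω _ fun p hp hps => hJ _ hps ⟨p, Or.inl hp, rfl⟩,
    I.Ja.setIntegral_Ioc_eq_zero ω _ fun p hp hps => hJ _ hps ⟨p, Or.inr hp, rfl⟩, add_zero,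
    sub_zero]

/-- As `r` increases to `u`, the drift over `(r, u]` is at most `vmax (u - r)` and vanishes in the
limit, leaving only the jump `d`. -/
theorem eq_left_add_of_increment {u : ℝ≥0} (hu : u ∈ Set.Ioc t M.T) (d : ℝ)
    (hd : ∀ r, t ≤ r → r < u → (∀ s ∈ Set.Ioo r u, s ∉ I.jumpTimes ω) →
      I.X u ω = I.X r ω + d + ∫ w in Set.Ioc r u, M.rate (c.v (w, ω)) (I.left w ω) ∂dt) :
    I.X u ω = I.left u ω + d := by
  have : (𝓝[<] u).NeBot := nhdsLT_neBot_of_exists_lt ⟨t, hu.1⟩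
  have h1 : Tendsto (fun r : ℝ≥0 => M.vmax * ((u : ℝ) - r)) (𝓝[<] u) (𝓝 0) := by
    have : Continuous fun r : ℝ≥0 => M.vmax * ((u : ℝ) - r) := by fun_prop
    simpa using (this.tendsto u).mono_left nhdsWithin_le_nhds
  have h2 : Tendsto (fun r => |I.X u ω - I.X r ω - d|) (𝓝[<] u)
      (𝓝 |I.X u ω - I.left u ω - d|) :=
    ((tendsto_const_nhds.sub (I.tendsto_left u ω)).sub tendsto_const_nhds).abs
  have h3 : |I.X u ω - I.left u ω - d| ≤ 0 := by
    refine le_of_tendsto_of_tendsto h2 h1 ?_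
    filter_upwards [Ioo_mem_nhdsLT hu.1, I.eventually_notMem_jumpTimes u ω] with r hr hrJ
    have := h.abs_setIntegral_rate_le hr.2.le hu.2
    rwa [show I.X u ω - I.X r ω - d =
      ∫ w in Set.Ioc r u, M.rate (c.v (w, ω)) (I.left w ω) ∂dt by
        rw [hd r hr.1.le hr.2 hrJ]; ring]
  linarith [abs_nonpos_iff.1 h3]

theorem X_bid {p : ℝ≥0 × ℝ} (hp : p ∈ I.Jb.points ω) (hpt : p.1 ∈ Set.Ioc t M.T) :
    I.X p.1 ω = I.left p.1 ω + p.2 := by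
  refine h.eq_left_add_of_increment hpt p.2 fun r htr hrp hJ => ?_
  rw [h.increment htr hrp.le hpt.2,
    I.Jb.setIntegral_Ioc_eq ω _ hp ⟨hrp, le_rfl⟩ fun p' hp' hs => ?_,
    I.Ja.setIntegral_Ioc_eq_zero ω _ fun p' hp' hs => ?_, sub_zero]
  · rcases hs.2.lt_or_eq with hlt | heq
    · exact hJ _ ⟨hs.1, hlt⟩ ⟨p', Or.inr hp', rfl⟩
    · exact h.no_common_jump p hp p' hp' heq.symm
  · rcases hs.2.lt_or_eq with hlt | heq
    · exact absurd ⟨p', Or.inl hp', rfl⟩ (hJ _ ⟨hs.1, hlt⟩)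
    · exact I.Jb.simple ω p' hp' p hp heq

theorem X_ask {p : ℝ≥0 × ℝ} (hp : p ∈ I.Ja.points ω) (hpt : p.1 ∈ Set.Ioc t M.T) :
    I.X p.1 ω = I.left p.1 ω - p.2 := by
  rw [sub_eq_add_neg]
  refine h.eq_left_add_of_increment hpt (-p.2) fun r htr hrp hJ => ?_
  rw [h.increment htr hrp.le hpt.2,
    I.Ja.setIntegral_Ioc_eq ω _ hp ⟨hrp, le_rfl⟩ fun p' hp' hs => ?_,
    I.Jb.setIntegral_Ioc_eq_zero ω _ fun p' hp' hs => ?_, add_zero, ← sub_eq_add_neg]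
  · rcases hs.2.lt_or_eq with hlt | heq
    · exact hJ _ ⟨hs.1, hlt⟩ ⟨p', Or.inl hp', rfl⟩
    · exact h.no_common_jump p' hp' p hp heq
  · rcases hs.2.lt_or_eq with hlt | heq
    · exact absurd ⟨p', Or.inr hp', rfl⟩ (hJ _ ⟨hs.1, hlt⟩)
    · exact I.Ja.simple ω p' hp' p hp heq

theorem X_mem_of_mem_jumpTimes {u : ℝ≥0} (hu : u ∈ I.jumpTimes ω) (hut : u ∈ Set.Ioc t M.T) :
    I.X u ω ∈ M.Q := by
  obtain ⟨p, hp | hp, rfl⟩ := hu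
  · rw [h.X_bid hp hut]
    exact h.bid_mem p hp hut
  · rw [h.X_ask hp hut]
    exact h.ask_mem p hp hut

/-- The inventory does not leave the set of allowed inventories. -/
theorem X_mem (hq : q₀ ∈ M.Q) {s : ℝ≥0} (hts : t ≤ s) (hs : s ≤ M.T) : I.X s ω ∈ M.Q := by
  have hfin : (I.jumpTimes ω ∩ Set.Ioc t M.T).Finite :=
    (I.finite_jumpTimes ω M.T).subset (Set.inter_subset_inter_right _ fun u hu => hu.2)
  constructor
  · rw [neg_le]
    -- The lower limit is an upper barrier for the reflected path.
    refine le_of_barrier (x := fun u => -I.X u ω) (K := M.vmax) hfin ?_ ?_ ?_ ?_ hts hs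
    · simpa only [I.X_init ω t le_rfl] using neg_le.1 hq.1
    · exact fun u hu h1 h2 => neg_le.1 (h.X_mem_of_mem_jumpTimes hu ⟨h1, h2⟩).1
    · intro r s htr hrs hsT hJ
      have h1 := h.increment_of_notMem htr hrs.le hsT hJ
      have h2 := abs_le.1 (h.abs_setIntegral_rate_le hrs.le hsT)
      linarith [h2.1]
    · intro r s htr hrs hsT hJ hc
      have h1 := h.increment_of_notMem htr hrs.le hsT hJ
      -- The rate is evaluated at left limits, which lie in the closed half-line `(-∞, -qmax]`
      -- because the preceding values do.
      have h2 : 0 ≤ ∫ u in Set.Ioc r s, M.rate (c.v (u, ω)) (I.left u ω) ∂dt :=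
        setIntegral_nonneg measurableSet_Ioc fun u hu => M.rate_nonneg _
          (I.left_mem_of_forall_mem isClosed_Iic hu.1
            fun w hrw hwu => by have := hc w ⟨hrw, hwu.le.trans hu.2⟩; exact (lt_neg.1 this).le)
      linarith
  · refine le_of_barrier (x := fun u => I.X u ω) (K := M.vmax) hfin ?_ ?_ ?_ ?_ hts hs
    · simpa only [I.X_init ω t le_rfl] using hq.2
    · exact fun u hu h1 h2 => (h.X_mem_of_mem_jumpTimes hu ⟨h1, h2⟩).2
    · intro r s htr hrs hsT hJ
      have h1 := h.increment_of_notMem htr hrs.le hsT hJ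
      have h2 := abs_le.1 (h.abs_setIntegral_rate_le hrs.le hsT)
      linarith [h2.2]
    · intro r s htr hrs hsT hJ hc
      have h1 := h.increment_of_notMem htr hrs.le hsT hJ
      have h2 : ∫ u in Set.Ioc r s, M.rate (c.v (u, ω)) (I.left u ω) ∂dt ≤ 0 :=
        setIntegral_nonpos measurableSet_Ioc fun u hu => M.rate_nonpos _
          (I.left_mem_of_forall_mem isClosed_Ici hu.1
            fun w hrw hwu => (hc w ⟨hrw, hwu.le.trans hu.2⟩).le)
      linarith

theorem left_mem (hq : q₀ ∈ M.Q) {s : ℝ≥0} (hs : s ≤ M.T) : I.left s ω ∈ M.Q := by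
  rcases le_or_gt s t with hst | hts
  · rwa [I.left_of_le hst]
  · exact I.left_mem_of_forall_mem isClosed_Icc hts
      fun r htr hrs => h.X_mem hq htr.le (hrs.le.trans hs)

/-- Without transactions and with control `v = 0`, the inventory is constant. -/
theorem left_eq_of_forall_notMem (hv : ∀ s, c.v (s, ω) = 0)
    (hJ : ∀ u ∈ Set.Ioc t M.T, u ∉ I.jumpTimes ω) {s : ℝ≥0} (hs : s ≤ M.T) :
    I.left s ω = q₀ := by
  rcases le_or_gt s t with hst | hts
  · exact I.left_of_le hst ω
  · refine I.left_mem_of_forall_mem isClosed_singleton hts fun r htr hrs => ?_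
    have := h.increment_of_notMem le_rfl htr.le (hrs.le.trans hs)
      fun u hu => hJ u ⟨hu.1, hu.2.trans (hrs.le.trans hs)⟩
    simpa [hv, M.rate_zero_left, I.X_init ω t le_rfl] using this

end RegularPath

end ControlledInventory

end MarketMaking

namespace MarketMaking

variable {Ω : Type*} {mΩ : MeasurableSpace Ω} {M : Model} {P : Measure Ω}
  {𝔽 : Filtration ℝ≥0 mΩ} {t : ℝ≥0} {q₀ : ℝ} {c : Control M P 𝔽}

/-! ### Bounds on the running reward -/

/-- Admissibility constrains the quotes only `dz`-almost everywhere; this transfers the constraint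
to trade sizes drawn from `μ`. -/
theorem SizeDistribution.absolutelyContinuous_restrict {μ : Measure ℝ} (h : SizeDistribution μ) :
    μ ≪ (volume : Measure ℝ).restrict (Set.Ioi 0) := by
  have hr : μ.restrict (Set.Ioi 0) = μ := Measure.restrict_eq_self_of_ae_mem h.ae_pos
  rw [← hr]
  exact h.absCont.restrict _

theorem Control.ae_quote_bound [SFinite P] (c : Control M P 𝔽) :
    ∀ᵐ ω ∂P, ∀ᵐ s ∂(dt.restrict (Set.Iic M.T)),
      (∀ᵐ z ∂M.μb, -M.δmin ≤ c.δb ((s, ω), z)) ∧ (∀ᵐ z ∂M.μa, -M.δmin ≤ c.δa ((s, ω), z)) := by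
  have h1 : ∀ᵐ x ∂((dt.restrict (Set.Iic M.T)).prod P),
      (∀ᵐ z ∂M.μb, -M.δmin ≤ c.δb (x, z)) ∧ (∀ᵐ z ∂M.μa, -M.δmin ≤ c.δa (x, z)) := by
    filter_upwards [Measure.ae_ae_of_ae_prod c.δ_bound] with x hx
    have hb := M.hμb.absolutelyContinuous_restrict.ae_le hx
    have ha := M.hμa.absolutelyContinuous_restrict.ae_le hx
    exact ⟨Eventually.mono hb fun z hz => hz.trans (min_le_left _ _),
      Eventually.mono ha fun z hz => hz.trans (min_le_right _ _)⟩
  exact Measure.ae_ae_of_ae_prod (Measure.measurePreserving_swap.quasiMeasurePreserving.ae h1)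

theorem SizeDistribution.integrable_of_abs_le {μ : Measure ℝ} (h : SizeDistribution μ) {f : ℝ → ℝ}
    {C : ℝ} (hf : Measurable f) (hC : ∀ᵐ z ∂μ, |f z| ≤ C * z) : Integrable f μ :=
  (h.finite_mean.const_mul C).mono' hf.aestronglyMeasurable hC

theorem SizeDistribution.integral_le {μ : Measure ℝ} (h : SizeDistribution μ) {f : ℝ → ℝ} {C : ℝ}
    (hf : Integrable f μ) (hC : ∀ᵐ z ∂μ, f z ≤ C * z) : ∫ z, f z ∂μ ≤ (∫ z, z ∂μ) * C := by
  rw [mul_comm, ← integral_const_mul]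
  exact integral_mono_ae hf (h.finite_mean.const_mul C) hC

theorem SizeDistribution.abs_integral_le {μ : Measure ℝ} (h : SizeDistribution μ) {f : ℝ → ℝ}
    {C : ℝ} (hC : ∀ᵐ z ∂μ, |f z| ≤ C * z) : |∫ z, f z ∂μ| ≤ (∫ z, z ∂μ) * C := by
  rw [mul_comm, ← integral_const_mul]
  exact norm_integral_le_of_norm_le (f := f) (h.finite_mean.const_mul C) hC

theorem Model.exists_bound_on_Q (M : Model) {f : ℝ → ℝ} (hf : Continuous f) :
    ∃ C, ∀ q ∈ M.Q, f q ≤ C := by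
  obtain ⟨C, hC⟩ := (isCompact_Icc (a := -M.qmax) (b := M.qmax)).exists_bound_of_continuousOn
    hf.continuousOn
  exact ⟨C, fun q hq => (le_abs_self _).trans (hC q hq)⟩

namespace ControlledInventory

variable (I : ControlledInventory M P 𝔽 t q₀ c)

theorem measurable_bidGain :
    Measurable fun x : (ℝ≥0 × Ω) × ℝ => I.bidGain x.1.1 x.1.2 x.2 := by
  have hl : Measurable fun x : (ℝ≥0 × Ω) × ℝ => I.left x.1.1 x.1.2 :=
    I.measurable_left.comp measurable_fst
  have hδ := c.δb_meas.of_predictableMarked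
  exact ((measurable_snd.mul hδ).mul (M.hΛb.continuous.measurable.comp hδ)).indicator
    (s := {x : (ℝ≥0 × Ω) × ℝ | I.left x.1.1 x.1.2 + x.2 ∈ M.Q})
    ((hl.add measurable_snd) (measurableSet_Icc (a := -M.qmax) (b := M.qmax)))

theorem measurable_askGain :
    Measurable fun x : (ℝ≥0 × Ω) × ℝ => I.askGain x.1.1 x.1.2 x.2 := by
  have hl : Measurable fun x : (ℝ≥0 × Ω) × ℝ => I.left x.1.1 x.1.2 :=
    I.measurable_left.comp measurable_fst
  have hδ := c.δa_meas.of_predictableMarked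
  exact ((measurable_snd.mul hδ).mul (M.hΛa.continuous.measurable.comp hδ)).indicator
    (s := {x : (ℝ≥0 × Ω) × ℝ | I.left x.1.1 x.1.2 - x.2 ∈ M.Q})
    ((hl.sub measurable_snd) (measurableSet_Icc (a := -M.qmax) (b := M.qmax)))

theorem measurable_running : Measurable fun p : ℝ≥0 × Ω => I.running p.1 p.2 := by
  have := M.hμb.prob
  have := M.hμa.prob
  have hv := c.v_meas.of_predictable
  have hl := I.measurable_left
  have hb := (I.measurable_bidGain.stronglyMeasurable.integral_prod_right' (ν := M.μb)).measurable
  have ha := (I.measurable_askGain.stronglyMeasurable.integral_prod_right' (ν := M.μa)).measurable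
  exact ((((hb.add ha).add ((hl.const_mul M.k).mul
    (M.continuous_rate.measurable.comp (hv.prodMk hl)))).sub
    (M.continuous_cost.measurable.comp (hv.prodMk hl))).sub (M.ψ_cont.measurable.comp hl))

theorem measurable_total : Measurable I.total :=
  (I.measurable_running.stronglyMeasurable.integral_prod_left'
    (μ := dt.restrict (Set.Ioc t M.T))).measurable.sub
      (M.ℓ_cont.measurable.comp (I.measurable_left.comp measurable_prodMk_left))

section Gains

variable {s : ℝ≥0} {ω : Ω}

theorem bidGain_le {z : ℝ} (hz : 0 < z) (hδ : -M.δmin ≤ c.δb ((s, ω), z)) :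
    I.bidGain s ω z ≤ M.Hb 0 * z := by
  refine Set.indicator_apply_le' (fun _ => ?_) fun _ => mul_nonneg M.Hb_nonneg hz.le
  rw [mul_assoc, mul_comm (M.Hb 0)]
  exact mul_le_mul_of_nonneg_left (M.mul_le_Hb hδ) hz.le

theorem askGain_le {z : ℝ} (hz : 0 < z) (hδ : -M.δmin ≤ c.δa ((s, ω), z)) :
    I.askGain s ω z ≤ M.Ha 0 * z := by
  refine Set.indicator_apply_le' (fun _ => ?_) fun _ => mul_nonneg M.Ha_nonneg hz.le
  rw [mul_assoc, mul_comm (M.Ha 0)]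
  exact mul_le_mul_of_nonneg_left (M.mul_le_Ha hδ) hz.le

theorem abs_bidGain_le {C z : ℝ} (hC : ∀ δ, -M.δmin ≤ δ → |δ * M.Λb δ| ≤ C) (hz : 0 < z)
    (hδ : -M.δmin ≤ c.δb ((s, ω), z)) : |I.bidGain s ω z| ≤ C * z := by
  have h := hC _ hδ
  have h1 : |z * c.δb ((s, ω), z) * M.Λb (c.δb ((s, ω), z))| ≤ C * z := by
    rw [mul_assoc, abs_mul, abs_of_pos hz, mul_comm]
    exact mul_le_mul_of_nonneg_right h hz.le
  exact (norm_indicator_le_norm_self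
    (fun z => z * c.δb ((s, ω), z) * M.Λb (c.δb ((s, ω), z))) z).trans h1

theorem abs_askGain_le {C z : ℝ} (hC : ∀ δ, -M.δmin ≤ δ → |δ * M.Λa δ| ≤ C) (hz : 0 < z)
    (hδ : -M.δmin ≤ c.δa ((s, ω), z)) : |I.askGain s ω z| ≤ C * z := by
  have h := hC _ hδ
  have h1 : |z * c.δa ((s, ω), z) * M.Λa (c.δa ((s, ω), z))| ≤ C * z := by
    rw [mul_assoc, abs_mul, abs_of_pos hz, mul_comm]
    exact mul_le_mul_of_nonneg_right h hz.le
  exact (norm_indicator_le_norm_self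
    (fun z => z * c.δa ((s, ω), z) * M.Λa (c.δa ((s, ω), z))) z).trans h1

theorem integrable_bidGain (hδ : ∀ᵐ z ∂M.μb, -M.δmin ≤ c.δb ((s, ω), z)) :
    Integrable (I.bidGain s ω) M.μb := by
  obtain ⟨C, -, hC⟩ := M.hΛb.exists_abs_mul_le M.δmin
  have hm : Measurable (I.bidGain s ω) := fun B hB =>
    measurable_prodMk_left (x := (s, ω)) (I.measurable_bidGain hB)
  refine M.hμb.integrable_of_abs_le (C := C) hm ?_
  filter_upwards [hδ, M.hμb.ae_pos] with z h1 h2 using I.abs_bidGain_le hC h2 h1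

theorem integrable_askGain (hδ : ∀ᵐ z ∂M.μa, -M.δmin ≤ c.δa ((s, ω), z)) :
    Integrable (I.askGain s ω) M.μa := by
  obtain ⟨C, -, hC⟩ := M.hΛa.exists_abs_mul_le M.δmin
  have hm : Measurable (I.askGain s ω) := fun B hB =>
    measurable_prodMk_left (x := (s, ω)) (I.measurable_askGain hB)
  refine M.hμa.integrable_of_abs_le (C := C) hm ?_
  filter_upwards [hδ, M.hμa.ae_pos] with z h1 h2 using I.abs_askGain_le hC h2 h1

theorem abs_drift_le (hq : I.left s ω ∈ M.Q) (hv : |c.v (s, ω)| ≤ M.vmax) :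
    |M.k * I.left s ω * M.rate (c.v (s, ω)) (I.left s ω)| ≤ M.k * M.vmax * M.qmax := by
  have h1 : |I.left s ω| ≤ M.qmax := abs_le.2 hq
  have h2 := (M.abs_rate_le (c.v (s, ω)) (I.left s ω)).trans hv
  rw [abs_mul, abs_mul, abs_of_pos M.k_pos, mul_assoc, mul_assoc, mul_comm M.vmax]
  exact mul_le_mul_of_nonneg_left (mul_le_mul h1 h2 (abs_nonneg _) M.qmax_pos.le) M.k_pos.le

theorem running_le (hq : I.left s ω ∈ M.Q) (hv : |c.v (s, ω)| ≤ M.vmax)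
    (hb : ∀ᵐ z ∂M.μb, -M.δmin ≤ c.δb ((s, ω), z))
    (ha : ∀ᵐ z ∂M.μa, -M.δmin ≤ c.δa ((s, ω), z)) :
    I.running s ω ≤ M.Δb * M.Hb 0 + M.Δa * M.Ha 0 + M.k * M.vmax * M.qmax := by
  have h1 : ∫ z, I.bidGain s ω z ∂M.μb ≤ M.Δb * M.Hb 0 :=
    M.hμb.integral_le (I.integrable_bidGain hb) (by
      filter_upwards [hb, M.hμb.ae_pos] with z h1 h2 using I.bidGain_le h2 h1)
  have h2 : ∫ z, I.askGain s ω z ∂M.μa ≤ M.Δa * M.Ha 0 :=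
    M.hμa.integral_le (I.integrable_askGain ha) (by
      filter_upwards [ha, M.hμa.ae_pos] with z h1 h2 using I.askGain_le h2 h1)
  have h3 := (abs_le.1 (I.abs_drift_le hq hv)).2
  have h4 := M.cost_nonneg (c.v (s, ω)) (I.left s ω)
  have h5 := M.ψ_nonneg (I.left s ω)
  unfold running
  linarith

end Gains

/-- The constant depends on neither time nor path, so integrability in `s` and then in `ω` follows
on finite measure spaces. -/
theorem exists_abs_running_le : ∃ C, ∀ {s : ℝ≥0} {ω : Ω}, I.left s ω ∈ M.Q →
    |c.v (s, ω)| ≤ M.vmax → (∀ᵐ z ∂M.μb, -M.δmin ≤ c.δb ((s, ω), z)) →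
    (∀ᵐ z ∂M.μa, -M.δmin ≤ c.δa ((s, ω), z)) → |I.running s ω| ≤ C := by
  obtain ⟨Cb, -, hCb⟩ := M.hΛb.exists_abs_mul_le M.δmin
  obtain ⟨Ca, -, hCa⟩ := M.hΛa.exists_abs_mul_le M.δmin
  obtain ⟨Cψ, hψ⟩ := M.exists_bound_on_Q M.ψ_cont
  refine ⟨M.Δb * Cb + M.Δa * Ca + M.k * M.vmax * M.qmax + (M.L (-M.vmax) + M.L M.vmax) + Cψ,
    fun {s ω} hq hv hb ha => ?_⟩
  have h1 : |∫ z, I.bidGain s ω z ∂M.μb| ≤ M.Δb * Cb := M.hμb.abs_integral_le (by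
      filter_upwards [hb, M.hμb.ae_pos] with z h1 h2 using I.abs_bidGain_le hCb h2 h1)
  have h2 : |∫ z, I.askGain s ω z ∂M.μa| ≤ M.Δa * Ca := M.hμa.abs_integral_le (by
      filter_upwards [ha, M.hμa.ae_pos] with z h1 h2 using I.abs_askGain_le hCa h2 h1)
  have h3 := abs_le.1 (I.abs_drift_le hq hv)
  have h4 := M.cost_nonneg (c.v (s, ω)) (I.left s ω)
  have h5 := M.cost_le hv (I.left s ω)
  have h6 := M.ψ_nonneg (I.left s ω)
  have h7 := hψ _ hq
  rw [abs_le] at h1 h2 ⊢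
  unfold running
  constructor <;> linarith

/-- For almost every `ω`, the path stays in `Q` and the control is admissible at almost every
time. -/
theorem ae_admissible [SFinite P] (hq : q₀ ∈ M.Q) :
    ∀ᵐ ω ∂P, I.left M.T ω ∈ M.Q ∧ ∀ᵐ s ∂(dt.restrict (Set.Ioc t M.T)), I.left s ω ∈ M.Q ∧
      |c.v (s, ω)| ≤ M.vmax ∧ (∀ᵐ z ∂M.μb, -M.δmin ≤ c.δb ((s, ω), z)) ∧
      (∀ᵐ z ∂M.μa, -M.δmin ≤ c.δa ((s, ω), z)) := by
  have hle : dt.restrict (Set.Ioc t M.T) ≤ dt.restrict (Set.Iic M.T) :=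
    Measure.restrict_mono (fun u hu => hu.2) le_rfl
  filter_upwards [I.ae_regularPath, c.ae_quote_bound] with ω h1 h2
  refine ⟨h1.left_mem hq le_rfl, ?_⟩
  filter_upwards [h1.abs_v_le.filter_mono (ae_mono hle), h2.filter_mono (ae_mono hle),
    ae_restrict_mem measurableSet_Ioc] with s h3 h4 h5
  exact ⟨h1.left_mem hq h5.2, h3, h4⟩

theorem ae_integrableOn_running [SFinite P] (hq : q₀ ∈ M.Q) :
    ∀ᵐ ω ∂P, IntegrableOn (fun s => I.running s ω) (Set.Ioc t M.T) dt := by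
  obtain ⟨C, hC⟩ := I.exists_abs_running_le
  filter_upwards [I.ae_admissible hq] with ω hω
  have hm : Measurable fun s => I.running s ω := fun B hB =>
    measurable_prodMk_right (y := ω) (I.measurable_running hB)
  exact Integrable.of_bound hm.aestronglyMeasurable C
    (hω.2.mono fun s hs => hC hs.1 hs.2.1 hs.2.2.1 hs.2.2.2)

theorem integrable_total [IsFiniteMeasure P] (htT : t ≤ M.T) (hq : q₀ ∈ M.Q) :
    Integrable I.total P := by
  obtain ⟨C, hC⟩ := I.exists_abs_running_le
  obtain ⟨Cℓ, hℓ⟩ := M.exists_bound_on_Q M.ℓ_cont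
  refine Integrable.of_bound I.measurable_total.aestronglyMeasurable (C * (M.T - t) + Cℓ) ?_
  filter_upwards [I.ae_admissible hq] with ω hω
  have h1 := norm_integral_le_of_norm_le_const (μ := dt.restrict (Set.Ioc t M.T))
    (f := fun s => I.running s ω) (C := C)
    (hω.2.mono fun s hs => hC hs.1 hs.2.1 hs.2.2.1 hs.2.2.2)
  rw [measureReal_restrict_apply_univ, dt_real_Ioc htT] at h1
  have h2 : ‖M.ℓ (I.left M.T ω)‖ ≤ Cℓ := by
    rw [Real.norm_of_nonneg (M.ℓ_nonneg _)]
    exact hℓ _ hω.1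
  exact (norm_sub_le _ _).trans (add_le_add h1 h2)

theorem wellDefined [IsFiniteMeasure P] (htT : t ≤ M.T) (hq : q₀ ∈ M.Q) : I.WellDefined := by
  refine ⟨?_, I.ae_integrableOn_running hq, I.integrable_total htT hq⟩
  filter_upwards [I.ae_admissible hq] with ω hω
  exact hω.2.mono fun s hs => ⟨I.integrable_bidGain hs.2.2.1, I.integrable_askGain hs.2.2.2⟩

theorem integral_total_le [IsProbabilityMeasure P] (htT : t ≤ M.T) (hq : q₀ ∈ M.Q) :
    ∫ ω, I.total ω ∂P ≤
      M.T * (M.Δb * M.Hb 0 + M.Δa * M.Ha 0 + M.k * M.vmax * M.qmax) := by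
  set U := M.Δb * M.Hb 0 + M.Δa * M.Ha 0 + M.k * M.vmax * M.qmax with hU
  -- Nonnegativity allows the length `T - t` to be replaced by `T`.
  have hU0 : 0 ≤ U := add_nonneg
    (add_nonneg (mul_nonneg M.Δb_nonneg M.Hb_nonneg) (mul_nonneg M.Δa_nonneg M.Ha_nonneg))
    (mul_nonneg (mul_nonneg M.k_pos.le M.vmax_pos.le) M.qmax_pos.le)
  have hbound : I.total ≤ᵐ[P] fun _ => M.T * U := by
    filter_upwards [I.ae_admissible hq, I.ae_integrableOn_running hq] with ω hω hint
    have h1 : ∫ s in Set.Ioc t M.T, I.running s ω ∂dt ≤ ∫ s in Set.Ioc t M.T, U ∂dt :=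
      integral_mono_ae hint (integrable_const U)
        (hω.2.mono fun s hs => I.running_le hs.1 hs.2.1 hs.2.2.1 hs.2.2.2)
    rw [setIntegral_const, dt_real_Ioc htT, smul_eq_mul] at h1
    have h2 : ((M.T : ℝ) - t) * U ≤ M.T * U :=
      mul_le_mul_of_nonneg_right (sub_le_self _ t.2) hU0
    exact (sub_le_self _ (M.ℓ_nonneg _)).trans (h1.trans h2)
  simpa using integral_mono_ae (I.integrable_total htT hq) (integrable_const _) hbound

end ControlledInventory

end MarketMaking

namespace MarketMaking

variable {Ω : Type*} {mΩ : MeasurableSpace Ω} {M : Model} {P : Measure Ω}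
  {𝔽 : Filtration ℝ≥0 mΩ} {t : ℝ≥0} {q₀ : ℝ} {c : Control M P 𝔽}

/-! ### Constant quotes and no execution -/

/-- A marked point process whose intensity is at most `κ` has points in `(t, T]` with probability
at most `κ (T - t)`. -/
theorem MarkedPointProcess.HasIntensityKernel.exists_measurableSet [IsProbabilityMeasure P]
    {J : MarkedPointProcess 𝔽} {T : ℝ≥0} {ν : ℝ≥0 → Ω → Measure ℝ}
    (h : J.HasIntensityKernel P t T ν) {κ : ℝ≥0∞} (hν : ∀ s ω, ν s ω Set.univ ≤ κ) :
    ∃ B, MeasurableSet B ∧ P B ≤ κ * ENNReal.ofReal (T - t) ∧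
      ∀ ω ∉ B, ∀ p ∈ J.points ω, p.1 ∉ Set.Ioc t T := by
  have hS : MeasurableSet (Set.Ioc t T ×ˢ (Set.univ : Set ℝ)) :=
    measurableSet_Ioc.prod MeasurableSet.univ
  have hm : Measurable fun ω => J.measure ω (Set.Ioc t T ×ˢ Set.univ) := by
    simpa using J.measurable_lintegral (H := fun _ => 1) measurable_const t T
  have hint : ∫⁻ ω, J.measure ω (Set.Ioc t T ×ˢ Set.univ) ∂P ≤ κ * ENNReal.ofReal (T - t) := by
    have h1 := h (fun _ => 1) (@measurable_const _ _ _ (predictableMarked 𝔽) 1)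
    simp only [lintegral_one, Measure.restrict_apply_univ] at h1
    rw [h1]
    calc ∫⁻ ω, ∫⁻ s in Set.Ioc t T, ν s ω Set.univ ∂dt ∂P
        ≤ ∫⁻ _, ∫⁻ _ in Set.Ioc t T, κ ∂dt ∂P :=
          lintegral_mono fun ω => lintegral_mono fun s => hν s ω
      _ = κ * ENNReal.ofReal (T - t) := by simp [dt_Ioc]
  -- Markov's inequality at level `1`: the number of points is an integer, so below `1` there are
  -- none.
  refine ⟨{ω | 1 ≤ J.measure ω (Set.Ioc t T ×ˢ Set.univ)}, measurableSet_le measurable_const hm,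
    ?_, fun ω hω p hp hpt => hω ?_⟩
  · have := mul_meas_ge_le_lintegral (μ := P) hm 1
    rw [one_mul] at this
    exact this.trans hint
  · have h1 : J.measure ω (Set.Ioc t T ×ˢ Set.univ) =
        ({p ∈ J.points ω | p ∈ Set.Ioc t T ×ˢ Set.univ}.encard : ℝ≥0∞) := J.measure_apply ω hS
    have h2 : (1 : ℕ∞) ≤ {p ∈ J.points ω | p ∈ Set.Ioc t T ×ˢ Set.univ}.encard :=
      Set.one_le_encard_iff_nonempty.2 ⟨p, hp, hpt, trivial⟩
    rw [Set.mem_ofPred_eq, h1]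
    exact_mod_cast h2

/-- The control with constant quotes `n` on both sides and no execution. -/
def Control.const (M : Model) (P : Measure Ω) (𝔽 : Filtration ℝ≥0 mΩ) (n : ℝ≥0) :
    Control M P 𝔽 where
  δb := fun _ => n
  δa := fun _ => n
  v := fun _ => 0
  δb_meas := @measurable_const _ _ _ (predictableMarked 𝔽) _
  δa_meas := @measurable_const _ _ _ (predictableMarked 𝔽) _
  v_meas := @measurable_const _ _ _ 𝔽.predictable _
  δ_bound := Eventually.of_forall fun _ => by
    rw [min_self]
    exact (neg_nonpos.2 M.δmin_pos.le).trans n.2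
  v_bound := Eventually.of_forall fun _ => by simpa using M.vmax_pos.le

theorem Model.bidKernel_const_univ_le (M : Model) (q δ : ℝ) :
    M.bidKernel q (fun _ => δ) Set.univ ≤ ENNReal.ofReal (M.Λb δ) := by
  have := M.hμb.prob
  rw [Model.bidKernel, withDensity_apply _ MeasurableSet.univ, Measure.restrict_univ]
  calc _ ≤ ∫⁻ _, ENNReal.ofReal (M.Λb δ) ∂M.μb :=
        lintegral_mono fun z => Set.indicator_le_self _ _ z
    _ = _ := by simp

theorem Model.askKernel_const_univ_le (M : Model) (q δ : ℝ) :
    M.askKernel q (fun _ => δ) Set.univ ≤ ENNReal.ofReal (M.Λa δ) := by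
  have := M.hμa.prob
  rw [Model.askKernel, withDensity_apply _ MeasurableSet.univ, Measure.restrict_univ]
  calc _ ≤ ∫⁻ _, ENNReal.ofReal (M.Λa δ) ∂M.μa :=
        lintegral_mono fun z => Set.indicator_le_self _ _ z
    _ = _ := by simp

namespace ControlledInventory

theorem neg_le_running_const {n : ℝ≥0} (I : ControlledInventory M P 𝔽 t q₀ (.const M P 𝔽 n))
    (s : ℝ≥0) (ω : Ω) : -M.ψ (I.left s ω) ≤ I.running s ω := by
  have hb : 0 ≤ ∫ z, I.bidGain s ω z ∂M.μb := integral_nonneg_of_ae <| by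
    filter_upwards [M.hμb.ae_pos] with z hz
    exact Set.indicator_apply_nonneg fun _ => mul_nonneg (mul_nonneg hz.le n.2) (M.hΛb.pos _).le
  have ha : 0 ≤ ∫ z, I.askGain s ω z ∂M.μa := integral_nonneg_of_ae <| by
    filter_upwards [M.hμa.ae_pos] with z hz
    exact Set.indicator_apply_nonneg fun _ => mul_nonneg (mul_nonneg hz.le n.2) (M.hΛa.pos _).le
  have hr : M.rate ((Control.const M P 𝔽 n).v (s, ω)) (I.left s ω) = 0 := M.rate_zero_left _
  have hc : M.cost ((Control.const M P 𝔽 n).v (s, ω)) (I.left s ω) = 0 := M.cost_zero_left _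
  rw [running, hr, hc]
  linarith

/-- Used twice: with the maxima over `Q` on paths with transactions, and with `ψ q₀`, `ℓ q₀` on
constant paths. -/
theorem le_total_const_of_forall_le {n : ℝ≥0}
    (I : ControlledInventory M P 𝔽 t q₀ (.const M P 𝔽 n)) (htT : t ≤ M.T) {ω : Ω} {Cψ Cℓ : ℝ}
    (hint : IntegrableOn (fun s => I.running s ω) (Set.Ioc t M.T) dt) (hCψ : 0 ≤ Cψ)
    (hψ : ∀ s ≤ M.T, M.ψ (I.left s ω) ≤ Cψ) (hℓ : M.ℓ (I.left M.T ω) ≤ Cℓ) :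
    -(M.T : ℝ) * Cψ - Cℓ ≤ I.total ω := by
  have h1 : ∫ s in Set.Ioc t M.T, -Cψ ∂dt ≤ ∫ s in Set.Ioc t M.T, I.running s ω ∂dt :=
    setIntegral_mono_on (integrable_const _) hint measurableSet_Ioc fun s hs =>
      (neg_le_neg (hψ s hs.2)).trans (I.neg_le_running_const s ω)
  rw [setIntegral_const, dt_real_Ioc htT, smul_eq_mul] at h1
  have h2 : ((M.T : ℝ) - t) * Cψ ≤ M.T * Cψ := mul_le_mul_of_nonneg_right (sub_le_self _ t.2) hCψ
  rw [total]
  linarith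

theorem le_integral_total_const [IsProbabilityMeasure P] {n : ℝ≥0}
    (I : ControlledInventory M P 𝔽 t q₀ (.const M P 𝔽 n)) (htT : t ≤ M.T) (hq : q₀ ∈ M.Q)
    {Cψ Cℓ : ℝ} (hψ : ∀ q ∈ M.Q, M.ψ q ≤ Cψ) (hℓ : ∀ q ∈ M.Q, M.ℓ q ≤ Cℓ) :
    -(M.T : ℝ) * M.ψ q₀ - M.ℓ q₀ - (M.T * Cψ + Cℓ) * ((M.Λb n + M.Λa n) * (M.T - t)) ≤
      ∫ ω, I.total ω ∂P := by
  obtain ⟨Bb, hBb, hPb, hJb⟩ := I.bid_intensity.exists_measurableSet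
    fun _ _ => M.bidKernel_const_univ_le _ (n : ℝ)
  obtain ⟨Ba, hBa, hPa, hJa⟩ := I.ask_intensity.exists_measurableSet
    fun _ _ => M.askKernel_const_univ_le _ (n : ℝ)
  have hT : (0 : ℝ) ≤ M.T - t := sub_nonneg.2 (by exact_mod_cast htT)
  have hCψ : 0 ≤ Cψ := (M.ψ_nonneg q₀).trans (hψ _ hq)
  have hCℓ : 0 ≤ Cℓ := (M.ℓ_nonneg q₀).trans (hℓ _ hq)
  set C : ℝ := M.T * Cψ + Cℓ with hC
  have hC0 : 0 ≤ C := add_nonneg (mul_nonneg M.T.2 hCψ) hCℓ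
  have hP : P.real (Bb ∪ Ba) ≤ (M.Λb n + M.Λa n) * (M.T - t) := by
    refine ENNReal.toReal_le_of_le_ofReal
      (mul_nonneg (add_nonneg (M.hΛb.pos _).le (M.hΛa.pos _).le) hT) ?_
    refine (measure_union_le _ _).trans ((add_le_add hPb hPa).trans_eq ?_)
    rw [← add_mul, ← ENNReal.ofReal_add (M.hΛb.pos _).le (M.hΛa.pos _).le,
      ← ENNReal.ofReal_mul (add_nonneg (M.hΛb.pos _).le (M.hΛa.pos _).le)]
  -- On the exceptional event the total is at least `-C`, and `-T ψ(q₀) - ℓ(q₀)` is nonpositive, so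
  -- subtracting `C` from it keeps a minorant.
  have hbound : (fun ω => -(M.T : ℝ) * M.ψ q₀ - M.ℓ q₀ -
      (Bb ∪ Ba).indicator (fun _ => C) ω) ≤ᵐ[P] I.total := by
    filter_upwards [I.ae_regularPath, I.ae_integrableOn_running hq] with ω hω hint
    by_cases hB : ω ∈ Bb ∪ Ba
    · rw [Set.indicator_of_mem hB]
      have h1 := I.le_total_const_of_forall_le htT hint hCψ
        (fun s hs => hψ _ (hω.left_mem hq hs)) (hℓ _ (hω.left_mem hq le_rfl))
      have h2 := mul_nonneg M.T.2 (M.ψ_nonneg q₀)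
      have h3 := M.ℓ_nonneg q₀
      simp only [NNReal.val_eq_coe] at h2
      linarith
    · rw [Set.indicator_of_notMem hB, sub_zero]
      have hconst : ∀ s ≤ M.T, I.left s ω = q₀ := fun s hs =>
        hω.left_eq_of_forall_notMem (fun _ => rfl) (by
          rintro u hu ⟨p, hp | hp, rfl⟩
          · exact hJb ω (fun h => hB (Or.inl h)) p hp hu
          · exact hJa ω (fun h => hB (Or.inr h)) p hp hu) hs
      exact I.le_total_const_of_forall_le htT hint (M.ψ_nonneg q₀)
        (fun s hs => by rw [hconst s hs]) (by rw [hconst _ le_rfl])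
  have hind : Integrable ((Bb ∪ Ba).indicator fun _ : Ω => C) P :=
    (integrable_const C).indicator (hBb.union hBa)
  have h := integral_mono_ae ((integrable_const _).sub hind) (I.integrable_total htT hq) hbound
  refine le_trans ?_ h
  rw [integral_sub' (integrable_const _) hind, integral_indicator_const C (hBb.union hBa)]
  simp only [integral_const, probReal_univ, smul_eq_mul, one_mul]
  have := mul_le_mul_of_nonneg_left hP hC0
  linarith

end ControlledInventory

end MarketMaking

/-! ### The main theorem -/

open MarketMaking in
theorem mainTheorem8 {Ω : Type*} {mΩ : MeasurableSpace Ω} (M : MarketMaking.Model)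
    (P : Measure Ω) [IsProbabilityMeasure P] (𝔽 : Filtration ℝ≥0 mΩ)
    (h𝔽 : MarketMaking.UsualConditions P 𝔽) (F : MarketMaking.InventoryFamily M P 𝔽) :
    (∀ t q c, (F t q c).WellDefined) ∧
    (∀ t q, IsLUB (Set.range (MarketMaking.criterion F t q)) (MarketMaking.valueFunction F t q)) ∧
    (∀ t q, MarketMaking.valueFunction F t q ≤
      (M.T : ℝ) * (M.Δb * M.Hb 0 + M.Δa * M.Ha 0 + M.k * M.vmax * M.qmax)) ∧
    (∀ (t : Set.Iic M.T) (q : M.Q), -(M.T : ℝ) * M.ψ q - M.ℓ q ≤ MarketMaking.valueFunction F t q) ∧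
    (∃ C : ℝ, ∀ t q, |MarketMaking.valueFunction F t q| ≤ C) := by
  have hne : Nonempty (Control M P 𝔽) := ⟨.const M P 𝔽 0⟩
  have hle : ∀ t q c, criterion F t q c ≤
      (M.T : ℝ) * (M.Δb * M.Hb 0 + M.Δa * M.Ha 0 + M.k * M.vmax * M.qmax) :=
    fun t q c => (F t q c).integral_total_le t.2 q.2
  have hbdd : ∀ t q, BddAbove (Set.range (criterion F t q)) := fun t q =>
    ⟨_, Set.forall_mem_range.2 (hle t q)⟩
  have hupper : ∀ t q, valueFunction F t q ≤
      (M.T : ℝ) * (M.Δb * M.Hb 0 + M.Δa * M.Ha 0 + M.k * M.vmax * M.qmax) :=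
    fun t q => ciSup_le (hle t q)
  obtain ⟨Cψ, hψ⟩ := M.exists_bound_on_Q M.ψ_cont
  obtain ⟨Cℓ, hℓ⟩ := M.exists_bound_on_Q M.ℓ_cont
  have hlower : ∀ (t : Set.Iic M.T) (q : M.Q),
      -(M.T : ℝ) * M.ψ q - M.ℓ q ≤ valueFunction F t q := by
    intro t q
    -- Only the intensities depend on `n`; the constants `Cψ`, `Cℓ` do not, so the error term tends
    -- to `0`.
    have hlim : Tendsto (fun n : ℕ => -(M.T : ℝ) * M.ψ q - M.ℓ q -
        (M.T * Cψ + Cℓ) * ((M.Λb (n : ℝ≥0) + M.Λa (n : ℝ≥0)) * (M.T - (t : ℝ≥0)))) atTop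
        (𝓝 (-(M.T : ℝ) * M.ψ q - M.ℓ q -
          (M.T * Cψ + Cℓ) * ((0 + 0) * (M.T - (t : ℝ≥0))))) := by
      simp only [NNReal.coe_natCast]
      exact tendsto_const_nhds.sub (((((M.hΛb.tendsto_zero.comp tendsto_natCast_atTop_atTop).add
        (M.hΛa.tendsto_zero.comp tendsto_natCast_atTop_atTop))).mul_const _).const_mul _)
    rw [add_zero, zero_mul, mul_zero, sub_zero] at hlim
    exact le_of_tendsto' hlim fun n =>
      ((F t q (.const M P 𝔽 n)).le_integral_total_const t.2 q.2 hψ hℓ).trans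
        (le_ciSup (hbdd t q) _)
  refine ⟨fun t q c => (F t q c).wellDefined t.2 q.2, fun t q => isLUB_ciSup (hbdd t q), hupper,
    hlower, _, fun t q => abs_le_max_abs_abs (a := -(M.T : ℝ) * Cψ - Cℓ) ?_ (hupper t q)⟩
  have h1 := mul_le_mul_of_nonneg_left (hψ q q.2) M.T.2
  simp only [NNReal.val_eq_coe] at h1
  linarith [hlower t q, hℓ q q.2]
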